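/- Let $\mathbb{H}$ be the complex upper half-plane, and for $\tau\in\mathbb{H}$ write $v=\operatorname{Im}\tau$ and $q^{\alpha}=e^{2\pi i\alpha\tau}$ for $\alpha\in\mathbb{R}$. Put $\zeta_N=e^{2\pi i/N}$, $(a;q)_n=\prod_{j=0}^{n-1}(1-aq^j)$ for $n\in\mathbb{N}_0\cup\{\infty\}$, and $\Gamma(a,x)=\int_x^{\infty}e^{-t}t^{a-1}\,dt$ for $x>0$. Consider the $q$-series $$S(q)=\sum_{n\ge 0}\frac{(q;q^2)_n^2\,q^{2n}}{(-q^2;q^2)_n}=\sum_{m\ge 0}c(m)q^m ,$$ and let $$A(q)=(q^2;q^2)_\infty\sum_{m\ge 0}c(2m)\,q^{m},$$ that is, $A(q)$ is $(q^2;q^2)_\infty$ times the part of $S(q)$ with even exponents, in which $q$ is replaced by $q^{1/2}$. Define $$A^{-}(\tau)=-\frac{1}{\sqrt{\pi}}\sum_{\varepsilon\in\{0,1\}}(-1)^{\varepsilon}\sum_{n,r\in\mathbb{Z}}\operatorname{sgn}\left(2r+\varepsilon+\tfrac13\right)\Gamma\left(\tfrac12,6\pi\left(2r+\varepsilon+\tfrac13\right)^2v\right)q^{-\frac32\left(2r+\varepsilon+\frac13\right)^2+\frac12\left(2n+\varepsilon+1\right)^2}$$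 and $$\widehat{A}(\tau)=q^{\frac13}A(q)+A^{-}(\tau).$$ Then, for all $\tau\in\mathbb{H}$, $$\widehat{A}(\tau+1)=\zeta_3\,\widehat{A}(\tau)\qquad\text{and}\qquad \widehat{A}\left(\frac{\tau}{2\tau+1}\right)=\zeta_{12}\,(2\tau+1)\,\widehat{A}(\tau).$$ -/

import Mathlib

noncomputable section

namespace SievedMock

/-- The finite `q`-Pochhammer symbol `(a; q)_n = ∏_{j=0}^{n-1} (1 - a q^j)`. -/
def qPoch {R : Type*} [CommRing R] (a q : R) (n : ℕ) : R :=
  ∏ j ∈ Finset.range n, (1 - a * q ^ j)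

/-- The infinite `q`-Pochhammer symbol `(a; q)_∞ = ∏_{j ≥ 0} (1 - a q^j)`, for `‖q‖ < 1`. -/
def qPochInf (a q : ℂ) : ℂ :=
  ∏' j : ℕ, (1 - a * q ^ j)

/-- The `n`-th summand `(q; q²)_n² q^{2n} / (-q²; q²)_n` of `S(q)`, as a formal power series
in the variable `q`. The denominator has constant coefficient `1`. -/
def termS (n : ℕ) : PowerSeries ℂ :=
  qPoch (PowerSeries.X : PowerSeries ℂ) (PowerSeries.X ^ 2) n ^ 2 * PowerSeries.X ^ (2 * n) *
    (qPoch (-PowerSeries.X ^ 2 : PowerSeries ℂ) (PowerSeries.X ^ 2) n)⁻¹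

/-- The `n`-th summand of `S(q)` does not contribute to the coefficients of `q^m`, `m < 2n`. -/
theorem coeff_termS_eq_zero {m n : ℕ} (h : m < 2 * n) :
    PowerSeries.coeff m (termS n) = 0 := by
  have hd : (PowerSeries.X : PowerSeries ℂ) ^ (2 * n) ∣ termS n :=
    Dvd.dvd.mul_right (Dvd.intro_left _ rfl) _
  exact PowerSeries.X_pow_dvd_iff.mp hd m h

/-- The denominators in `S(q)` are invertible formal power series. -/
theorem qPoch_mul_inv (n : ℕ) :
    qPoch (-PowerSeries.X ^ 2 : PowerSeries ℂ) (PowerSeries.X ^ 2) n *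
      (qPoch (-PowerSeries.X ^ 2 : PowerSeries ℂ) (PowerSeries.X ^ 2) n)⁻¹ = 1 := by
  apply PowerSeries.mul_inv_cancel
  simp [qPoch, map_prod]

/-- The `q`-series `S(q) = ∑_{n ≥ 0} (q; q²)_n² q^{2n} / (-q²; q²)_n`. Its coefficient of `q^m` is
the sum of the coefficients of `q^m` in all summands; those with `n > m` contribute `0`
(see `coeff_termS_eq_zero`). -/
def seriesS : PowerSeries ℂ :=
  PowerSeries.mk fun m => ∑ n ∈ Finset.range (m + 1), PowerSeries.coeff m (termS n)

/-- The sieving operator `f | S_{N,r}`, which keeps the terms with exponent `≡ r (mod N)`. -/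
def sieve (N : ℕ) (r : ℤ) (f : PowerSeries ℂ) : PowerSeries ℂ :=
  open scoped Classical in
  PowerSeries.mk fun n => if (n : ℤ) ≡ r [ZMOD N] then PowerSeries.coeff n f else 0

/-- The value at `z` of the `q`-series `f(q)`. -/
def evalSeries (f : PowerSeries ℂ) (z : ℂ) : ℂ :=
  ∑' n : ℕ, PowerSeries.coeff n f * z ^ n

/-- `q^α = e^{2πiατ}` for real exponents `α`. -/
def qpow (τ : ℂ) (α : ℝ) : ℂ :=
  Complex.exp (2 * Real.pi * Complex.I * α * τ)

/-- `A(q) = (q²; q²)_∞ [S(q) | S_{2,0}]_{q ↦ q^{1/2}}` with `q = e^{2πiτ}`. -/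
def A (τ : ℂ) : ℂ :=
  qPochInf (qpow τ 1 ^ 2) (qpow τ 1 ^ 2) * evalSeries (sieve 2 0 seriesS) (qpow τ (1 / 2))

/-- The incomplete gamma function `Γ(a, x) = ∫_x^∞ e^{-t} t^{a-1} dt`, for `x > 0`. -/
def incGamma (a x : ℝ) : ℝ :=
  ∫ t in Set.Ioi x, Real.exp (-t) * t ^ (a - 1)

/-- The non-holomorphic part `A⁻(τ)`, where `v = Im τ`. -/
def Aminus (τ : ℂ) : ℂ :=
  -(1 / (Real.sqrt Real.pi : ℂ)) * ∑ ε ∈ Finset.range 2, (-1 : ℂ) ^ ε *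
    ∑' p : ℤ × ℤ,
      (Real.sign (2 * (p.2 : ℝ) + (ε : ℝ) + 1 / 3) : ℂ) *
      (incGamma (1 / 2) (6 * Real.pi * (2 * (p.2 : ℝ) + (ε : ℝ) + 1 / 3) ^ 2 * τ.im) : ℂ) *
      qpow τ (-(3 / 2) * (2 * (p.2 : ℝ) + (ε : ℝ) + 1 / 3) ^ 2
        + 1 / 2 * (2 * (p.1 : ℝ) + (ε : ℝ) + 1) ^ 2)

/-- The completed function `Â(τ) = q^{1/3} A(q) + A⁻(τ)`. -/
def Ahat (τ : ℂ) : ℂ :=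
  qpow τ (1 / 3) * A τ + Aminus τ

/-- `ζ_N = e^{2πi/N}`. -/
def zeta (N : ℕ) : ℂ :=
  Complex.exp (2 * Real.pi * Complex.I / N)

end SievedMock

end

open Filter Topology

noncomputable section

namespace SievedMock

/-! The argument writes $q^{1/3}A(q)$ as an indefinite theta series and then exhibits its completion
as an integral of Siegel theta functions, each of which is modular.

The $q$-series half: with $q=w^2$, the finite Jacobi triple product expands $(w;w^2)_n^2$ as a sum
over $j$ of $(-1)^j w^{j^2}$ times a Gaussian binomial, and passing to the even part in $w$ keeps
the even $j$. Exchanging sums gives $\sum_j q^{2j^2}F_{2j}(q)$, where $F_j$ is `qF`. A telescoping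
recursion linking $F_j$ and $F_{j+2}$ (`qF_add_qF`), iterated, turns $(q^2;q^2)_\infty F_{2j}$ into
a partial theta series (`hasSum_theta_tail`). Hence
$q^{1/3}A=\sum_{k,j}(-1)^{k+j}\,\sigma(k,j)\,q^{3(k+1/3)^2-j^2}$, with $\sigma=\pm1$ on the two
halves of the cone $|j|<|k+\frac13|$ and $0$ outside (`qpow_mul_A`).

The modular half: $\sigma$ is the mean of $\operatorname{sgn}(k+\frac13-j)$ and
$\operatorname{sgn}(k+\frac13+j)$. Replacing each sign by an error function subtracts incomplete
gamma terms, one family for each wall of the cone. The reflection $j\mapsto -j$ exchanges the walls,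
so both families have the same sum, and a change of lattice coordinates identifies the correction
with $A^-$ (`Aminus_eq`). The resulting mean of error functions, times $q^{3x^2-y^2}$, is up to the
factor $\sqrt{2v}$ the integral along an arc of the hyperbola $c^2-s^2=1$ of a Gaussian attached to
the form $6x^2-2y^2$ times a linear form; summing over the lattice gives `Ahat_eq_integral`.

It remains to transform `siegelTheta` at each point of the arc. Translation by $1$ is read off from
the exponents. For $\tau\mapsto\tau/(2\tau+1)$, Poisson summation passes to a dual theta function at
$-1/\tau$, where the map becomes a shift by $-2$ (`dualTheta_sub_two`). The automorphy factor
$(2\tau+1)|2\tau+1|$ loses its modulus against $\sqrt{\operatorname{Im}\tau}$, which leaves weight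
one. -/

/-! ### Evaluation of the formal series $S(q)$ in the unit disc -/

/-- The power series `f` converges absolutely at `w`, with value `v`, and its coefficients weighted
by the powers of `‖w‖` have `ℓ¹`-norm at most `B`. -/
structure HasEval (f : PowerSeries ℂ) (w v : ℂ) (B : ℝ) : Prop where
  hasSum : HasSum (fun m => PowerSeries.coeff m f * w ^ m) v
  summable : Summable fun m => ‖PowerSeries.coeff m f‖ * ‖w‖ ^ m
  tsum_le : ∑' m, ‖PowerSeries.coeff m f‖ * ‖w‖ ^ m ≤ B

theorem HasEval.mul {f g : PowerSeries ℂ} {w v v' : ℂ} {B B' : ℝ} (hf : HasEval f w v B)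
    (hg : HasEval g w v' B') : HasEval (f * g) w (v * v') (B * B') := by
  have hf' : Summable fun m => ‖PowerSeries.coeff m f * w ^ m‖ := by
    simpa [norm_mul, norm_pow] using hf.summable
  have hg' : Summable fun m => ‖PowerSeries.coeff m g * w ^ m‖ := by
    simpa [norm_mul, norm_pow] using hg.summable
  have key : ∀ n, PowerSeries.coeff n (f * g) * w ^ n =
      ∑ p ∈ Finset.HasAntidiagonal.antidiagonal n,
        (PowerSeries.coeff p.1 f * w ^ p.1) * (PowerSeries.coeff p.2 g * w ^ p.2) := by
    intro n
    rw [PowerSeries.coeff_mul, Finset.sum_mul]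
    refine Finset.sum_congr rfl fun p hp => ?_
    rw [← Finset.HasAntidiagonal.mem_antidiagonal.mp hp, pow_add]
    ring
  have hs := summable_norm_sum_mul_antidiagonal_of_summable_norm hf' hg'
  have hs' : Summable fun m => ‖PowerSeries.coeff m (f * g)‖ * ‖w‖ ^ m := by
    simpa [← key, norm_mul, norm_pow] using hs
  have hf0 : Summable fun m => ‖(‖PowerSeries.coeff m f‖ * ‖w‖ ^ m)‖ := by
    simpa using hf.summable
  have hg0 : Summable fun m => ‖(‖PowerSeries.coeff m g‖ * ‖w‖ ^ m)‖ := by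
    simpa using hg.summable
  refine ⟨?_, hs', ?_⟩
  · have := tsum_mul_tsum_eq_tsum_sum_antidiagonal_of_summable_norm hf' hg'
    rw [hf.hasSum.tsum_eq, hg.hasSum.tsum_eq] at this
    rw [this]
    simp only [key]
    exact hs.of_norm.hasSum
  · calc ∑' m, ‖PowerSeries.coeff m (f * g)‖ * ‖w‖ ^ m
        ≤ ∑' n, ∑ p ∈ Finset.HasAntidiagonal.antidiagonal n,
          (‖PowerSeries.coeff p.1 f‖ * ‖w‖ ^ p.1) * (‖PowerSeries.coeff p.2 g‖ * ‖w‖ ^ p.2) := by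
          refine hs'.tsum_le_tsum (fun n => ?_)
            (summable_norm_sum_mul_antidiagonal_of_summable_norm hf0 hg0).of_norm
          rw [← norm_pow, ← norm_mul, key]
          refine (norm_sum_le _ _).trans (le_of_eq ?_)
          simp [norm_pow]
      _ = (∑' m, ‖PowerSeries.coeff m f‖ * ‖w‖ ^ m) *
          ∑' m, ‖PowerSeries.coeff m g‖ * ‖w‖ ^ m :=
          (tsum_mul_tsum_eq_tsum_sum_antidiagonal_of_summable_norm hf0 hg0).symm
      _ ≤ B * B' := by
          refine mul_le_mul hf.tsum_le hg.tsum_le (tsum_nonneg fun _ => by positivity) ?_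
          exact (tsum_nonneg fun _ => by positivity).trans hf.tsum_le

theorem hasEval_X_pow (w : ℂ) (k : ℕ) : HasEval (PowerSeries.X ^ k) w (w ^ k) (‖w‖ ^ k) := by
  have h1 : (fun m => PowerSeries.coeff m (PowerSeries.X ^ k : PowerSeries ℂ) * w ^ m) =
      fun m => if m = k then w ^ k else 0 := by
    funext m; rw [PowerSeries.coeff_X_pow]; split_ifs with h <;> simp [h]
  have h2 : (fun m => ‖PowerSeries.coeff m (PowerSeries.X ^ k : PowerSeries ℂ)‖ * ‖w‖ ^ m) =
      fun m => if m = k then ‖w‖ ^ k else 0 := by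
    funext m; rw [PowerSeries.coeff_X_pow]; split_ifs with h <;> simp [h]
  refine ⟨?_, ?_, ?_⟩
  · rw [h1]; exact hasSum_ite_eq _ _
  · rw [h2]; exact (hasSum_ite_eq _ _).summable
  · rw [h2, (hasSum_ite_eq k (‖w‖ ^ k)).tsum_eq]

theorem HasEval.sub {f g : PowerSeries ℂ} {w v v' : ℂ} {B B' : ℝ} (hf : HasEval f w v B)
    (hg : HasEval g w v' B') : HasEval (f - g) w (v - v') (B + B') := by
  have hb : ∀ m, ‖PowerSeries.coeff m (f - g)‖ * ‖w‖ ^ m ≤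
      ‖PowerSeries.coeff m f‖ * ‖w‖ ^ m + ‖PowerSeries.coeff m g‖ * ‖w‖ ^ m := by
    intro m
    rw [map_sub, ← add_mul]
    gcongr
    exact norm_sub_le _ _
  have hs := (hf.summable.add hg.summable).of_nonneg_of_le (fun m => by positivity) hb
  refine ⟨?_, hs, ?_⟩
  · simpa [sub_mul] using hf.hasSum.sub hg.hasSum
  · refine (hs.tsum_le_tsum hb (hf.summable.add hg.summable)).trans ?_
    rw [hf.summable.tsum_add hg.summable]
    exact add_le_add hf.tsum_le hg.tsum_le

theorem hasEval_one (w : ℂ) : HasEval 1 w 1 1 := by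
  simpa using hasEval_X_pow w 0

theorem hasEval_inv_one_add_X_pow {w : ℂ} (hw : ‖w‖ < 1) {k : ℕ} (hk : k ≠ 0) :
    HasEval (1 + PowerSeries.X ^ k)⁻¹ w (1 + w ^ k)⁻¹ (1 - ‖w‖ ^ k)⁻¹ := by
  classical
  have hinj : Function.Injective fun i : ℕ => k * i := fun a b h => by
    simpa [hk] using h
  have hinv : (1 + PowerSeries.X ^ k : PowerSeries ℂ)⁻¹ =
      PowerSeries.mk fun m => if k ∣ m then (-1 : ℂ) ^ (m / k) else 0 := by
    rw [PowerSeries.inv_eq_iff_mul_eq_one (by simp [hk]), mul_add, mul_one]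
    ext m
    rw [map_add, PowerSeries.coeff_mul_X_pow', PowerSeries.coeff_mk, PowerSeries.coeff_one]
    by_cases hm : k ≤ m
    · rw [if_pos hm, PowerSeries.coeff_mk, if_neg (show m ≠ 0 by omega)]
      obtain ⟨l, rfl⟩ := Nat.exists_eq_add_of_le hm
      simp only [Nat.add_sub_cancel_left, Nat.dvd_add_self_left, Nat.add_div_left l (Nat.pos_of_ne_zero hk)]
      split_ifs <;> simp [pow_succ]
    · rw [if_neg hm, add_zero]
      rcases Nat.eq_zero_or_pos m with rfl | hm0
      · simp
      · rw [if_neg (Nat.not_dvd_of_pos_of_lt hm0 (not_le.mp hm)), if_neg (by omega)]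
  rw [hinv]
  have e1 : ∀ m ∉ Set.range fun i : ℕ => k * i, ¬ k ∣ m := fun m hm h => by
    obtain ⟨i, rfl⟩ := h; exact hm ⟨i, rfl⟩
  have hn : ‖w ^ k‖ < 1 := by
    rw [norm_pow]; exact pow_lt_one₀ (norm_nonneg _) hw hk
  have hS : HasSum (fun m => ‖PowerSeries.coeff m
      (PowerSeries.mk fun m => if k ∣ m then (-1 : ℂ) ^ (m / k) else 0)‖ * ‖w‖ ^ m)
      (1 - ‖w‖ ^ k)⁻¹ := by
    rw [← hinj.hasSum_iff (fun m hm => by simp [e1 m hm])]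
    rw [norm_pow] at hn
    convert hasSum_geometric_of_lt_one (by positivity) hn using 1
    funext i
    simp [Function.comp, Nat.mul_div_cancel_left i (Nat.pos_of_ne_zero hk), pow_mul]
  refine ⟨?_, hS.summable, hS.tsum_eq.le⟩
  rw [← hinj.hasSum_iff (fun m hm => by simp [e1 m hm])]
  have := hasSum_geometric_of_norm_lt_one (ξ := -w ^ k) (by simpa using hn)
  rw [sub_neg_eq_add] at this
  have he : (fun i : ℕ => (-w ^ k) ^ i) = (fun m => PowerSeries.coeff m
      (PowerSeries.mk fun m => if k ∣ m then (-1 : ℂ) ^ (m / k) else 0) * w ^ m) ∘ (k * ·) := by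
    funext i
    simp [Function.comp, Nat.mul_div_cancel_left i (Nat.pos_of_ne_zero hk), pow_mul]
    rw [neg_pow (w ^ k)]
  rwa [he] at this

theorem qPoch_succ {R : Type*} [CommRing R] (a q : R) (n : ℕ) :
    qPoch a q (n + 1) = qPoch a q n * (1 - a * q ^ n) := by
  simp [qPoch, Finset.prod_range_succ]

theorem qPoch_zero {R : Type*} [CommRing R] (a q : R) : qPoch a q 0 = 1 := by
  simp [qPoch]

/-- Each new factor $(1-X^{2n+1})^2X^2(1+X^{2n+2})^{-1}$ has weighted $\ell^1$-norm at most the new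
factor of the product, and these norms are submultiplicative. A bound on coefficients, not merely on
values, is what permits rearranging the double sum over summands and coefficients. -/
theorem hasEval_termS {w : ℂ} (hw : ‖w‖ < 1) (n : ℕ) :
    HasEval (termS n) w
      (qPoch w (w ^ 2) n ^ 2 * w ^ (2 * n) * (qPoch (-w ^ 2) (w ^ 2) n)⁻¹)
      (∏ j ∈ Finset.range n,
        ((1 + ‖w‖ ^ (2 * j + 1)) ^ 2 * ‖w‖ ^ 2 * (1 - ‖w‖ ^ (2 * j + 2))⁻¹)) := by
  induction n with
  | zero => simpa [termS, qPoch_zero] using hasEval_one w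
  | succ n ih =>
    have h1 : HasEval (1 - PowerSeries.X ^ (2 * n + 1)) w (1 - w ^ (2 * n + 1))
        (1 + ‖w‖ ^ (2 * n + 1)) := (hasEval_one w).sub (hasEval_X_pow w _)
    have h2 := ((h1.mul h1).mul (hasEval_X_pow w 2)).mul
      (hasEval_inv_one_add_X_pow hw (k := 2 * n + 2) (by omega))
    convert ih.mul h2 using 1
    · simp only [termS, qPoch_succ, PowerSeries.mul_inv_rev]
      rw [show (1 - -PowerSeries.X ^ 2 * (PowerSeries.X ^ 2) ^ n : PowerSeries ℂ) =
        1 + PowerSeries.X ^ (2 * n + 2) by ring]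
      ring
    · simp only [qPoch_succ, mul_inv]
      rw [show (1 - -w ^ 2 * (w ^ 2) ^ n : ℂ) = 1 + w ^ (2 * n + 2) by ring]
      ring
    · rw [Finset.prod_range_succ]; ring

/-- Ratio test: the factor of index $n$ tends to $r^2<1$. The case $r=0$ is separate because the
ratio test needs nonzero terms. -/
theorem summable_termS_bound {r : ℝ} (h0 : 0 ≤ r) (h1 : r < 1) :
    Summable fun n : ℕ => ∏ j ∈ Finset.range n,
      ((1 + r ^ (2 * j + 1)) ^ 2 * r ^ 2 * (1 - r ^ (2 * j + 2))⁻¹) := by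
  rcases h0.eq_or_lt with rfl | h0
  · refine summable_of_ne_finset_zero (s := {0}) fun n hn => ?_
    refine Finset.prod_eq_zero (i := 0) (by simpa [Nat.pos_iff_ne_zero] using hn) (by simp)
  have hpos : ∀ j : ℕ, 0 < (1 + r ^ (2 * j + 1)) ^ 2 * r ^ 2 * (1 - r ^ (2 * j + 2))⁻¹ := fun j => by
    have : r ^ (2 * j + 2) < 1 := pow_lt_one₀ h0.le h1 (by omega)
    have : 0 < 1 - r ^ (2 * j + 2) := by linarith
    positivity
  refine summable_of_ratio_test_tendsto_lt_one (l := r ^ 2) (by nlinarith)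
    (Eventually.of_forall fun n => (Finset.prod_pos fun j _ => hpos j).ne') ?_
  have ht : Tendsto (fun n : ℕ => r ^ n) atTop (𝓝 0) := tendsto_pow_atTop_nhds_zero_of_lt_one h0.le h1
  have hm : Tendsto (fun n : ℕ => 2 * n + 1) atTop atTop :=
    tendsto_atTop_mono (fun n => by simp only [id]; omega) tendsto_id
  have hm' : Tendsto (fun n : ℕ => 2 * n + 2) atTop atTop :=
    tendsto_atTop_mono (fun n => by simp only [id]; omega) tendsto_id
  have := ((((ht.comp hm).const_add 1).pow 2).mul_const (r ^ 2)).mul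
    ((((ht.comp hm').const_sub 1)).inv₀ (by simp))
  simp only [add_zero, sub_zero, one_pow, one_mul, inv_one, mul_one] at this
  refine this.congr fun n => ?_
  rw [Finset.prod_range_succ, norm_mul, mul_div_cancel_left₀ _
    (norm_ne_zero_iff.mpr (Finset.prod_pos fun j _ => hpos j).ne'), Real.norm_of_nonneg (hpos n).le]
  simp

/-- The formal series `S(q)` converges in the unit disc to the sum of its summands. -/
theorem hasSum_seriesS {w : ℂ} (hw : ‖w‖ < 1) :
    Summable (fun n => qPoch w (w ^ 2) n ^ 2 * w ^ (2 * n) * (qPoch (-w ^ 2) (w ^ 2) n)⁻¹) ∧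
    HasSum (fun m => PowerSeries.coeff m seriesS * w ^ m)
      (∑' n, qPoch w (w ^ 2) n ^ 2 * w ^ (2 * n) * (qPoch (-w ^ 2) (w ^ 2) n)⁻¹) := by
  have hB := summable_termS_bound (norm_nonneg w) hw
  -- Absolute convergence of the double family allows summing first over coefficients (giving the
  -- analytic sum) or first over $n$ (giving the coefficients of `seriesS`).
  have hs : Summable fun p : ℕ × ℕ => ‖PowerSeries.coeff p.2 (termS p.1) * w ^ p.2‖ := by
    rw [summable_prod_of_nonneg fun _ => norm_nonneg _]
    simp only [norm_mul, norm_pow]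
    exact ⟨fun n => (hasEval_termS hw n).summable, hB.of_nonneg_of_le
      (fun n => tsum_nonneg fun m => by positivity) fun n => (hasEval_termS hw n).tsum_le⟩
  have hs' := hs.of_norm
  have h1 := hs'.hasSum.prod_fiberwise fun n => (hasEval_termS hw n).hasSum
  refine ⟨h1.summable, ?_⟩
  rw [h1.tsum_eq]
  have h2 := (Equiv.prodComm ℕ ℕ).hasSum_iff.mpr hs'.hasSum
  refine h2.prod_fiberwise fun m => ?_
  simp only [Function.comp, Equiv.prodComm_apply, Prod.swap, seriesS, PowerSeries.coeff_mk,
    Finset.sum_mul]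
  refine hasSum_sum_of_ne_finset_zero fun n hn => ?_
  rw [coeff_termS_eq_zero, zero_mul]
  simp only [Finset.mem_range, not_lt] at hn
  omega

/-- The even part is the average of the values at $w$ and $-w$; only the factor $(w;w^2)_n^2$ is
sensitive to the sign. -/
theorem evalSeries_sieve_seriesS {w : ℂ} (hw : ‖w‖ < 1) :
    evalSeries (sieve 2 0 seriesS) w = ∑' n : ℕ,
      (qPoch w (w ^ 2) n ^ 2 + qPoch (-w) (w ^ 2) n ^ 2) / 2 * w ^ (2 * n) *
        (qPoch (-w ^ 2) (w ^ 2) n)⁻¹ := by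
  obtain ⟨hs, h⟩ := hasSum_seriesS hw
  obtain ⟨hs', h'⟩ := hasSum_seriesS (w := -w) (by simpa using hw)
  have hh := (h.add h').div_const 2
  have : (fun m => (PowerSeries.coeff m seriesS * w ^ m + PowerSeries.coeff m seriesS * (-w) ^ m) / 2)
      = fun m => PowerSeries.coeff m (sieve 2 0 seriesS) * w ^ m := by
    funext m
    rw [sieve, PowerSeries.coeff_mk]
    rcases Nat.even_or_odd m with hm | hm
    · rw [hm.neg_pow, if_pos]
      · ring
      · simpa [Int.modEq_zero_iff_dvd] using (Int.natCast_dvd_natCast.mpr hm.two_dvd)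
    · rw [hm.neg_pow, if_neg]
      · ring
      · have := Nat.odd_iff.mp hm
        simp only [Int.ModEq, Nat.cast_ofNat]
        omega
  rw [this] at hh
  rw [evalSeries, hh.tsum_eq, ← hs.tsum_add hs', ← tsum_div_const]
  refine tsum_congr fun n => ?_
  simp only [neg_sq, (even_two_mul n).neg_pow]
  ring

/-! ### Finite triple product and the conjugate Bailey pair recursion -/

/-- `1 / (q; q)_k`, extended by `0` to negative `k`. -/
def qFactInv (q : ℂ) (k : ℤ) : ℂ :=
  if 0 ≤ k then (qPoch q q k.toNat)⁻¹ else 0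

theorem one_sub_mul_pow_ne_zero {a q : ℂ} (ha : ‖a‖ < 1) (hq : ‖q‖ < 1) (n : ℕ) :
    1 - a * q ^ n ≠ 0 := by
  intro h
  have h1 : ‖a * q ^ n‖ < 1 := by
    rw [norm_mul, norm_pow]
    calc ‖a‖ * ‖q‖ ^ n ≤ ‖a‖ * 1 := by
          gcongr; exact pow_le_one₀ (norm_nonneg _) hq.le
      _ < 1 := by linarith
  rw [← sub_eq_zero.mp h] at h1
  simp at h1

theorem qPoch_ne_zero {a q : ℂ} (ha : ‖a‖ < 1) (hq : ‖q‖ < 1) (n : ℕ) : qPoch a q n ≠ 0 :=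
  Finset.prod_ne_zero_iff.mpr fun j _ => one_sub_mul_pow_ne_zero ha hq j

theorem summable_norm_neg_mul_pow (a : ℂ) {q : ℂ} (hq : ‖q‖ < 1) :
    Summable fun n : ℕ => ‖-(a * q ^ n)‖ := by
  simp only [norm_neg, norm_mul, norm_pow]
  exact (summable_geometric_of_lt_one (norm_nonneg _) hq).mul_left _

theorem tendsto_qPoch (a : ℂ) {q : ℂ} (hq : ‖q‖ < 1) :
    Tendsto (qPoch a q) atTop (𝓝 (qPochInf a q)) := by
  have h := (multipliable_one_add_of_summable (summable_norm_neg_mul_pow a hq)).hasProd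
  simp only [← sub_eq_add_neg] at h
  exact h.tendsto_prod_nat

theorem qPochInf_ne_zero {a q : ℂ} (ha : ‖a‖ < 1) (hq : ‖q‖ < 1) : qPochInf a q ≠ 0 := by
  have := tprod_one_add_ne_zero_of_summable (f := fun n : ℕ => -(a * q ^ n))
    (fun n => by rw [← sub_eq_add_neg]; exact one_sub_mul_pow_ne_zero ha hq n)
    (summable_norm_neg_mul_pow a hq)
  simp only [← sub_eq_add_neg] at this
  exact this

theorem qFactInv_sub_one {q : ℂ} (hq : ‖q‖ < 1) (k : ℤ) :
    qFactInv q (k - 1) = (1 - q ^ k) * qFactInv q k := by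
  rcases lt_trichotomy k 0 with h | rfl | h
  · simp [qFactInv, not_le.mpr h, show ¬ 1 ≤ k by omega]
  · simp [qFactInv]
  · obtain ⟨n, rfl⟩ : ∃ n : ℕ, k = n + 1 := ⟨(k - 1).toNat, by omega⟩
    have h1 := one_sub_mul_pow_ne_zero hq hq n
    rw [qFactInv, qFactInv, if_pos (by omega), if_pos (by omega), add_sub_cancel_right,
      Int.toNat_natCast, show ((n : ℤ) + 1).toNat = n + 1 by omega, qPoch_succ, mul_inv,
      show q ^ ((n : ℤ) + 1) = q * q ^ n by rw [← Nat.cast_succ, zpow_natCast, pow_succ']]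
    field_simp

theorem qFactInv_sub_two {q : ℂ} (hq : ‖q‖ < 1) (k : ℤ) :
    qFactInv q (k - 2) = (1 - q ^ (k - 1)) * (1 - q ^ k) * qFactInv q k := by
  rw [show k - 2 = k - 1 - 1 by ring, qFactInv_sub_one hq, qFactInv_sub_one hq]; ring

theorem qFactInv_of_neg (q : ℂ) {k : ℤ} (hk : k < 0) : qFactInv q k = 0 := by
  simp [qFactInv, not_le.mpr hk]

theorem hasSum_of_eq {ι : Type*} {f g : ι → ℂ} {a b : ℂ} (h : HasSum f a) (hf : ∀ i, g i = f i)
    (ha : b = a) : HasSum g b := by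
  rw [ha, funext hf]; exact h

/-- The finite Jacobi triple product. -/
theorem hasSum_finite_jacobi {w : ℂ} (hw0 : w ≠ 0) (hw : ‖w ^ 2‖ < 1) (n : ℕ) :
    HasSum (fun j : ℤ => (-1) ^ j * w ^ (j ^ 2) * qPoch (w ^ 2) (w ^ 2) (2 * n) *
      (qFactInv (w ^ 2) (n - j) * qFactInv (w ^ 2) (n + j))) (qPoch w (w ^ 2) n ^ 2) := by
  induction n with
  | zero =>
    convert hasSum_single (0 : ℤ) (fun j hj => ?_) using 1
    · simp [qPoch_zero, qFactInv]
    · rcases lt_or_gt_of_ne hj with h | h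
      · rw [qFactInv_of_neg _ (k := ((0 : ℕ) : ℤ) + j) (by simpa using h)]; ring
      · rw [qFactInv_of_neg _ (k := ((0 : ℕ) : ℤ) - j) (by simpa using h)]; ring
  | succ n ih =>
    have h1 := (Equiv.addRight (-1 : ℤ)).hasSum_iff.mpr ih
    have h2 := (Equiv.addRight (1 : ℤ)).hasSum_iff.mpr ih
    -- The induction uses $(1-w^{2n+1})^2=(1+w^{4n+2})-2w^{2n+1}$. The two copies of $w^{2n+1}$ are
    -- matched with the expansion shifted by $j\mapsto j-1$ and by $j\mapsto j+1$, so that the terms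
    -- combine into the next Gaussian binomial.
    have h3 := (ih.mul_left (1 + w ^ (2 * (2 * n + 1)))).sub
      ((h1.add h2).mul_left (w ^ (2 * n + 1)))
    refine hasSum_of_eq h3 (fun j => ?_) ?_
    · simp only [Function.comp, Equiv.coe_addRight]
      rw [show (n : ℤ) - (j + -1) = (n + 1 : ℕ) - j by push_cast; ring,
        show (n : ℤ) + (j + -1) = ((n + 1 : ℕ) + j) - 2 by push_cast; ring,
        show (n : ℤ) - (j + 1) = ((n + 1 : ℕ) - j) - 2 by push_cast; ring,
        show (n : ℤ) + (j + 1) = (n + 1 : ℕ) + j by push_cast; ring,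
        show (n : ℤ) - j = ((n + 1 : ℕ) - j) - 1 by push_cast; ring,
        show (n : ℤ) + j = ((n + 1 : ℕ) + j) - 1 by push_cast; ring]
      simp only [qFactInv_sub_one hw, qFactInv_sub_two hw]
      generalize qFactInv (w ^ 2) (((n + 1 : ℕ) : ℤ) - j) = u
      generalize qFactInv (w ^ 2) (((n + 1 : ℕ) : ℤ) + j) = v
      rw [show 2 * (n + 1) = 2 * n + 1 + 1 by ring, qPoch_succ, qPoch_succ]
      generalize qPoch (w ^ 2) (w ^ 2) (2 * n) = Q
      have hs1 : (-1 : ℂ) ^ (j + -1) = -(-1) ^ j := by rw [zpow_add₀ (by norm_num)]; norm_num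
      have hs2 : (-1 : ℂ) ^ (j + 1) = -(-1) ^ j := by rw [zpow_add₀ (by norm_num)]; norm_num
      have hw1 : w ^ ((j + -1) ^ 2) = w ^ (j ^ 2) * ((w ^ j) ^ 2)⁻¹ * w := by
        rw [show (j + -1) ^ 2 = j ^ 2 - 2 * j + 1 by ring, zpow_add₀ hw0, zpow_sub₀ hw0,
          zpow_mul' w 2 j, zpow_one]
        simp [div_eq_mul_inv]
      have hw2 : w ^ ((j + 1) ^ 2) = w ^ (j ^ 2) * (w ^ j) ^ 2 * w := by
        rw [show (j + 1) ^ 2 = j ^ 2 + 2 * j + 1 by ring, zpow_add₀ hw0, zpow_add₀ hw0,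
          zpow_mul' w 2 j, zpow_one]
        rfl
      rw [hs1, hs2, hw1, hw2]
      have hzz : (w ^ 2) ^ j = (w ^ j) ^ 2 := by
        rw [← zpow_natCast, ← zpow_natCast, ← zpow_mul, ← zpow_mul, mul_comm]
      have hX : (w ^ 2) ^ (((n + 1 : ℕ) : ℤ) - j) = (w ^ n) ^ 2 * w ^ 2 * ((w ^ j) ^ 2)⁻¹ := by
        rw [zpow_sub₀ (pow_ne_zero 2 hw0), zpow_natCast, hzz]; ring
      have hX' : (w ^ 2) ^ (((n + 1 : ℕ) : ℤ) - j - 1) = (w ^ n) ^ 2 * ((w ^ j) ^ 2)⁻¹ := by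
        rw [zpow_sub_one₀ (pow_ne_zero 2 hw0), hX]; field_simp
      have hY : (w ^ 2) ^ (((n + 1 : ℕ) : ℤ) + j) = (w ^ n) ^ 2 * w ^ 2 * (w ^ j) ^ 2 := by
        rw [zpow_add₀ (pow_ne_zero 2 hw0), zpow_natCast, hzz]; ring
      have hY' : (w ^ 2) ^ (((n + 1 : ℕ) : ℤ) + j - 1) = (w ^ n) ^ 2 * (w ^ j) ^ 2 := by
        rw [zpow_sub_one₀ (pow_ne_zero 2 hw0), hY]; field_simp
      rw [hX, hX', hY, hY']
      have hj : w ^ j ≠ 0 := zpow_ne_zero _ hw0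
      rw [show w ^ (2 * n + 1) = (w ^ n) ^ 2 * w by ring,
        show w ^ (2 * (2 * n + 1)) = (w ^ n) ^ 4 * w ^ 2 by ring,
        show (w ^ 2) ^ (2 * n) = (w ^ n) ^ 4 by ring,
        show (w ^ 2) ^ (2 * n + 1) = (w ^ n) ^ 4 * w ^ 2 by ring]
      generalize w ^ n = N
      generalize w ^ j = J at *
      field_simp
      ring
    · rw [qPoch_succ]; ring

/-- Averaging the triple product over $\pm w$ kills odd $j$, since $j^2$ has the parity of $j$. -/
theorem hasSum_qPoch_even {w : ℂ} (hw0 : w ≠ 0) (hw : ‖w ^ 2‖ < 1) (n : ℕ) :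
    HasSum (fun j : ℤ => (w ^ 2) ^ (2 * j ^ 2) * qPoch (w ^ 2) (w ^ 2) (2 * n) *
      (qFactInv (w ^ 2) (n - 2 * j) * qFactInv (w ^ 2) (n + 2 * j)))
      ((qPoch w (w ^ 2) n ^ 2 + qPoch (-w) (w ^ 2) n ^ 2) / 2) := by
  have h1 := hasSum_finite_jacobi hw0 hw n
  have h2 := hasSum_finite_jacobi (w := -w) (neg_ne_zero.mpr hw0) (by simpa using hw) n
  rw [neg_sq] at h2
  have h3 := (h1.add h2).div_const 2
  have hinj : Function.Injective fun j : ℤ => 2 * j := fun a b h => by simpa using h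
  rw [← hinj.hasSum_iff] at h3
  · refine hasSum_of_eq h3 (fun j => ?_) rfl
    have e1 : (-w) ^ ((2 * j) ^ 2) = w ^ ((2 * j) ^ 2) :=
      Even.neg_zpow (by simp [Int.even_pow]) w
    have e2 : (-1 : ℂ) ^ (2 * j) = 1 := Even.neg_one_zpow (by simp)
    have e3 : w ^ ((2 * j) ^ 2) = (w ^ 2) ^ (2 * j ^ 2) := by
      rw [← zpow_natCast w 2, ← zpow_mul]; congr 1; push_cast; ring
    simp only [Function.comp, e1, e2, e3]
    ring
  · intro j hj
    have hodd : Odd j := by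
      rw [← Int.not_even_iff_odd]
      rintro ⟨i, rfl⟩
      exact hj ⟨i, by simp only; ring⟩
    rw [Odd.neg_zpow (hodd.pow) w]
    ring

/-- `(q; q)_{2n} / (-q; q)_n`. -/
def qD (q : ℂ) (n : ℕ) : ℂ :=
  qPoch q q (2 * n) * (qPoch (-q) q n)⁻¹

theorem qD_succ {q : ℂ} (hq : ‖q‖ < 1) (n : ℕ) :
    qD q (n + 1) = qD q n * ((1 - q * (q ^ n) ^ 2) * (1 - q * q ^ n)) := by
  have h := one_sub_mul_pow_ne_zero (a := -q) (by simpa using hq) hq n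
  rw [qD, qD, show 2 * (n + 1) = 2 * n + 1 + 1 by ring, qPoch_succ, qPoch_succ, qPoch_succ]
  simp only [neg_mul, sub_neg_eq_add] at h ⊢
  field_simp
  ring

theorem tendsto_qFactInv {q : ℂ} (hq : ‖q‖ < 1) :
    Tendsto (qFactInv q) atTop (𝓝 (qPochInf q q)⁻¹) := by
  have h := (tendsto_qPoch q hq).inv₀ (qPochInf_ne_zero hq hq)
  have ht : Tendsto Int.toNat atTop atTop :=
    tendsto_atTop.mpr fun b => (eventually_ge_atTop (b : ℤ)).mono fun k hk => by omega
  refine (h.comp ht).congr' ((eventually_ge_atTop 0).mono fun k hk => ?_)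
  simp [qFactInv, hk]

theorem tendsto_intCast_add (c : ℤ) : Tendsto (fun n : ℕ => (n : ℤ) + c) atTop atTop :=
  tendsto_atTop_add_const_right _ _ tendsto_natCast_atTop_atTop

theorem tendsto_qD {q : ℂ} (hq : ‖q‖ < 1) :
    Tendsto (qD q) atTop (𝓝 (qPochInf q q * (qPochInf (-q) q)⁻¹)) := by
  have hm : Tendsto (fun n : ℕ => 2 * n) atTop atTop :=
    tendsto_atTop_mono (fun n => by simp only [id]; omega) tendsto_id
  exact ((tendsto_qPoch q hq).comp hm).mul
    ((tendsto_qPoch (-q) hq).inv₀ (qPochInf_ne_zero (by simpa using hq) hq))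

theorem qPochInf_mul_neg {q : ℂ} (hq : ‖q‖ < 1) :
    qPochInf q q * qPochInf (-q) q = qPochInf (q ^ 2) (q ^ 2) := by
  have hq2 : ‖q ^ 2‖ < 1 := by rw [norm_pow]; exact pow_lt_one₀ (norm_nonneg _) hq two_ne_zero
  refine tendsto_nhds_unique ((tendsto_qPoch q hq).mul (tendsto_qPoch (-q) hq))
    ((tendsto_qPoch (q ^ 2) hq2).congr fun n => ?_)
  rw [qPoch, qPoch, qPoch, ← Finset.prod_mul_distrib]
  exact Finset.prod_congr rfl fun j _ => by ring

theorem exists_norm_qFactInv_le {q : ℂ} (hq : ‖q‖ < 1) : ∃ C, ∀ k, ‖qFactInv q k‖ ≤ C := by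
  have h := (tendsto_qPoch q hq).inv₀ (qPochInf_ne_zero hq hq)
  obtain ⟨C, hC⟩ := (Metric.isBounded_range_of_tendsto _ h).exists_norm_le
  refine ⟨C, fun k => ?_⟩
  rw [qFactInv]
  split_ifs
  · exact hC _ ⟨k.toNat, rfl⟩
  · rw [norm_zero]; exact (norm_nonneg _).trans (hC _ ⟨0, rfl⟩)

/-- All three factors are terms of convergent sequences, or zero. Uniformity in all indices makes
$q^n$ alone a majorant for `qF`, independently of $j$. -/
theorem exists_norm_qD_mul_le {q : ℂ} (hq : ‖q‖ < 1) :
    ∃ C, ∀ n k l, ‖qD q n * (qFactInv q k * qFactInv q l)‖ ≤ C := by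
  obtain ⟨C, hC⟩ := exists_norm_qFactInv_le hq
  obtain ⟨C', hC'⟩ := (Metric.isBounded_range_of_tendsto _ (tendsto_qD hq)).exists_norm_le
  have h0 : 0 ≤ C := (norm_nonneg _).trans (hC 0)
  refine ⟨C' * (C * C), fun n k l => ?_⟩
  rw [norm_mul, norm_mul]
  exact mul_le_mul (hC' _ ⟨n, rfl⟩) (mul_le_mul (hC k) (hC l) (norm_nonneg _) h0) (by positivity)
    ((norm_nonneg _).trans (hC' _ ⟨0, rfl⟩))

/-- `F_j(q) = ∑_n q^n (q; q)_{2n} / ((-q; q)_n (q; q)_{n-j} (q; q)_{n+j})`. -/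
def qF (q : ℂ) (j : ℤ) : ℂ :=
  ∑' n : ℕ, q ^ n * (qD q n * (qFactInv q (n - j) * qFactInv q (n + j)))

theorem summable_qF {q : ℂ} (hq : ‖q‖ < 1) (j : ℤ) :
    Summable fun n : ℕ => q ^ n * (qD q n * (qFactInv q (n - j) * qFactInv q (n + j))) := by
  obtain ⟨C, hC⟩ := exists_norm_qD_mul_le hq
  refine ((summable_geometric_of_lt_one (norm_nonneg _) hq).mul_right C).of_norm_bounded fun n => ?_
  rw [norm_mul, norm_pow]
  exact mul_le_mul_of_nonneg_left (hC _ _ _) (by positivity)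

theorem exists_norm_qF_le {q : ℂ} (hq : ‖q‖ < 1) : ∃ C, ∀ j, ‖qF q j‖ ≤ C := by
  obtain ⟨C, hC⟩ := exists_norm_qD_mul_le hq
  have hs := (summable_geometric_of_lt_one (norm_nonneg _) hq).mul_right C
  refine ⟨∑' n : ℕ, ‖q‖ ^ n * C, fun j => tsum_of_norm_bounded hs.hasSum fun n => ?_⟩
  rw [norm_mul, norm_pow]
  exact mul_le_mul_of_nonneg_left (hC _ _ _) (by positivity)

theorem qF_neg (q : ℂ) (j : ℤ) : qF q (-j) = qF q j := by
  refine tsum_congr fun n => ?_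
  rw [sub_neg_eq_add, ← sub_eq_add_neg, mul_comm (qFactInv q _)]

/-- The recursion for the conjugate Bailey pair, obtained by telescoping. -/
theorem qF_add_qF {q : ℂ} (hq0 : q ≠ 0) (hq : ‖q‖ < 1) (j : ℕ) :
    qF q j + q ^ (3 * j + 3) * qF q (j + 2) =
      q ^ j * (1 + q ^ (j + 1)) * (qPochInf (q ^ 2) (q ^ 2))⁻¹ := by
  -- Telescoping certificate: `G (n + 1) - G n` is the $n$-th summand of the left side. Its limit is
  -- the right side, because
  -- $\frac{(q)_\infty}{(-q)_\infty}\cdot\frac1{(q)_\infty^2}=\frac1{(q^2;q^2)_\infty}$.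
  set G : ℕ → ℂ := fun n => q ^ j * (1 + q ^ (j + 1)) *
    (qD q n * (qFactInv q (n - j - 1) * qFactInv q (n + j + 1))) with hG
  have hs := ((summable_qF hq j).add ((summable_qF hq (j + 2)).mul_left (q ^ (3 * j + 3))))
  have htel : ∀ n : ℕ, G (n + 1) - G n =
      q ^ n * (qD q n * (qFactInv q (n - j) * qFactInv q (n + j))) + q ^ (3 * j + 3) *
      (q ^ n * (qD q n * (qFactInv q (n - (j + 2)) * qFactInv q (n + (j + 2))))) := by
    intro n
    simp only [hG, qD_succ hq]
    rw [show ((n + 1 : ℕ) : ℤ) - j - 1 = n - j by push_cast; ring,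
      show ((n + 1 : ℕ) : ℤ) + j + 1 = n + (j + 2) by push_cast; ring,
      show (n : ℤ) - (j + 2) = n - j - 2 by ring,
      show (n : ℤ) + j + 1 = n + (j + 2) - 1 by ring,
      show (n : ℤ) + j = n + (j + 2) - 2 by ring]
    simp only [qFactInv_sub_one hq, qFactInv_sub_two hq]
    generalize qFactInv q ((n : ℤ) - j) = u
    generalize qFactInv q ((n : ℤ) + (j + 2)) = v
    generalize qD q n = D
    have e1 : q ^ ((n : ℤ) - j) = q ^ n * (q ^ j)⁻¹ := by
      rw [zpow_sub₀ hq0]; simp [div_eq_mul_inv]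
    have e2 : q ^ ((n : ℤ) + (j + 2)) = q ^ n * q ^ j * q ^ 2 := by
      rw [zpow_add₀ hq0, zpow_add₀ hq0]; norm_cast; ring
    rw [zpow_sub_one₀ hq0, zpow_sub_one₀ hq0, e1, e2, show q ^ (3 * j + 3) = (q ^ j) ^ 3 * q ^ 3 by ring,
      pow_succ q j]
    have hj : q ^ j ≠ 0 := pow_ne_zero _ hq0
    generalize q ^ n = N
    generalize q ^ j = J at *
    field_simp
    ring
  have hlim : Tendsto G atTop
      (𝓝 (q ^ j * (1 + q ^ (j + 1)) * (qPochInf (q ^ 2) (q ^ 2))⁻¹)) := by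
    have h1 := (tendsto_qFactInv hq).comp (tendsto_intCast_add (-j - 1))
    have h2 := (tendsto_qFactInv hq).comp (tendsto_intCast_add (j + 1))
    have h3 := ((tendsto_qD hq).mul (h1.mul h2)).const_mul (q ^ j * (1 + q ^ (j + 1)))
    have e : qPochInf q q * (qPochInf (-q) q)⁻¹ * ((qPochInf q q)⁻¹ * (qPochInf q q)⁻¹) =
        (qPochInf (q ^ 2) (q ^ 2))⁻¹ := by
      have := qPochInf_ne_zero hq hq
      rw [← qPochInf_mul_neg hq, mul_inv]
      field_simp
    rw [e] at h3
    refine h3.congr fun n => ?_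
    simp only [hG, Function.comp]
    ring_nf
  have hsum := hs.hasSum.tendsto_sum_nat
  rw [(summable_qF hq j).tsum_add ((summable_qF hq (j + 2)).mul_left _), tsum_mul_left] at hsum
  refine tendsto_nhds_unique hsum (hlim.congr fun n => ?_)
  rw [← Finset.sum_congr rfl fun n _ => htel n, Finset.sum_range_sub]
  simp only [hG]
  -- The lower boundary term `G 0` vanishes, since $1/(q;q)_{-j-1}=0$ by convention.
  rw [qFactInv_of_neg q (k := ((0 : ℕ) : ℤ) - j - 1) (by push_cast; omega)]
  ring

theorem summable_norm_pow_sq {r : ℝ} (h0 : 0 ≤ r) (h1 : r < 1) :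
    Summable fun j : ℤ => r ^ (2 * j.natAbs ^ 2) := by
  have hn : Summable fun j : ℕ => r ^ (2 * j ^ 2) :=
    (summable_geometric_of_lt_one h0 h1).of_nonneg_of_le (fun j => by positivity)
      fun j => pow_le_pow_of_le_one h0 h1.le (by nlinarith)
  refine Summable.of_nat_of_neg ?_ ?_ <;> simpa using hn

theorem zpow_two_mul_sq (q : ℂ) (j : ℤ) : q ^ (2 * j ^ 2) = q ^ (2 * j.natAbs ^ 2) := by
  rw [← zpow_natCast]; congr 1; push_cast; rw [sq_abs]

/-- Insert the even triple product into the sum over $n$ and exchange the sums over $n$ and $j$;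
$|q|^n|q|^{2j^2}$ is a majorant up to a constant. -/
theorem hasSum_even_part {w : ℂ} (hw0 : w ≠ 0) (hw : ‖w‖ < 1) :
    HasSum (fun j : ℤ => (w ^ 2) ^ (2 * j ^ 2) * qF (w ^ 2) (2 * j))
      (evalSeries (sieve 2 0 seriesS) w) := by
  have hq : ‖w ^ 2‖ < 1 := by rw [norm_pow]; exact pow_lt_one₀ (norm_nonneg _) hw two_ne_zero
  have hJ := fun n => hasSum_qPoch_even hw0 hq n
  rw [evalSeries_sieve_seriesS hw]
  have hpow : ∀ n : ℕ, w ^ (2 * n) = (w ^ 2) ^ n := fun n => pow_mul _ _ _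
  simp only [hpow]
  generalize w ^ 2 = q at *
  set f : ℕ × ℤ → ℂ := fun p => q ^ (2 * p.2 ^ 2) * (q ^ p.1 *
    (qD q p.1 * (qFactInv q (p.1 - 2 * p.2) * qFactInv q (p.1 + 2 * p.2)))) with hf
  obtain ⟨C, hC⟩ := exists_norm_qD_mul_le hq
  have hs : Summable f := by
    have h1 := (summable_geometric_of_lt_one (norm_nonneg _) hq).mul_of_nonneg
      (summable_norm_pow_sq (norm_nonneg _) hq) (fun n => by positivity) (fun n => by positivity)
    refine (h1.mul_right C).of_norm_bounded fun p => ?_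
    simp only [hf]
    rw [zpow_two_mul_sq, norm_mul, norm_mul, norm_pow, norm_pow, ← mul_assoc,
      mul_comm (‖q‖ ^ (2 * _))]
    exact mul_le_mul_of_nonneg_left (hC _ _ _) (by positivity)
  have h0 : ∀ n : ℕ, HasSum (fun j => f (n, j)) ((qPoch w q n ^ 2 + qPoch (-w) q n ^ 2) / 2 *
      (q ^ n * (qPoch (-q) q n)⁻¹)) := fun n =>
    hasSum_of_eq ((hJ n).mul_right (q ^ n * (qPoch (-q) q n)⁻¹))
      (fun j => by simp only [hf, qD]; ring) rfl
  have h1 := hs.hasSum.prod_fiberwise h0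
  have h2 : ∑' p, f p = ∑' n : ℕ, (qPoch w q n ^ 2 + qPoch (-w) q n ^ 2) / 2 * q ^ n *
        (qPoch (-q) q n)⁻¹ := by
    rw [← h1.tsum_eq]
    refine tsum_congr fun n => ?_
    ring
  rw [← h2]
  refine ((Equiv.prodComm ℤ ℕ).hasSum_iff.mpr hs.hasSum).prod_fiberwise fun j => ?_
  exact hasSum_of_eq ((summable_qF hq (2 * j)).hasSum.mul_left (q ^ (2 * j ^ 2)))
    (fun n => by simp only [hf, Function.comp, Equiv.prodComm_apply, Prod.swap]) rfl

/-! ### Partial theta series and the Hecke-type double sum -/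

/-- The `k`-th term of the series in `hasSum_theta_tail`. -/
def thetaTerm (q : ℂ) (k : ℕ) : ℂ :=
  (-1) ^ k * q ^ (3 * k ^ 2 + 2 * k) * (1 + q ^ (2 * k + 1))

theorem tendsto_const_mul_pow_sq {q : ℂ} (hq : ‖q‖ < 1) :
    Tendsto (fun k : ℕ => ‖q‖ ^ (3 * k ^ 2)) atTop (𝓝 0) :=
  (tendsto_pow_atTop_nhds_zero_of_lt_one (norm_nonneg q) hq).comp
    (tendsto_atTop_mono (fun n => by simp only [id]; nlinarith) tendsto_id)

theorem summable_of_pow_le {q : ℂ} (hq : ‖q‖ < 1) {e : ℕ → ℕ} (he : ∀ k, k ≤ e k) :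
    Summable fun k : ℕ => (-1 : ℂ) ^ k * q ^ e k := by
  refine (summable_geometric_of_lt_one (norm_nonneg q) hq).of_norm_bounded fun k => ?_
  rw [norm_mul, norm_pow, norm_pow, norm_neg, norm_one, one_pow, one_mul]
  exact pow_le_pow_of_le_one (norm_nonneg _) hq.le (he k)

theorem thetaTerm_eq (q : ℂ) (k : ℕ) : thetaTerm q k =
    (-1) ^ k * q ^ (3 * k ^ 2 + 2 * k) + (-1) ^ k * q ^ (3 * k ^ 2 + 4 * k + 1) := by
  rw [thetaTerm]; ring

theorem hasSum_theta_tail {q : ℂ} (hq0 : q ≠ 0) (hq : ‖q‖ < 1) (j : ℕ) :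
    HasSum (fun k => thetaTerm q (k + j))
      ((-1) ^ j * q ^ (3 * j ^ 2) * qPochInf (q ^ 2) (q ^ 2) * qF q (2 * j)) := by
  set H : ℕ → ℂ := fun j => (-1) ^ j * q ^ (3 * j ^ 2) * qPochInf (q ^ 2) (q ^ 2) * qF q (2 * j)
    with hH
  have hq2 : ‖q ^ 2‖ < 1 := by rw [norm_pow]; exact pow_lt_one₀ (norm_nonneg _) hq two_ne_zero
  have hP := qPochInf_ne_zero hq2 hq2
  -- The recursion at $2k$, multiplied by $(-1)^kq^{3k^2}(q^2;q^2)_\infty$, telescopes because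
  -- $3k^2+(6k+3)=3(k+1)^2$.
  have htel : ∀ k, thetaTerm q k = H k - H (k + 1) := by
    intro k
    have h := qF_add_qF hq0 hq (2 * k)
    push_cast at h
    have h' : q ^ (2 * k) * (1 + q ^ (2 * k + 1)) =
        (qF q (2 * k) + q ^ (3 * (2 * k) + 3) * qF q (2 * k + 2)) * qPochInf (q ^ 2) (q ^ 2) := by
      rw [h]; field_simp
    rw [thetaTerm, pow_add, ← mul_assoc, mul_assoc, h']
    simp only [hH]
    rw [show (2 * ((k + 1 : ℕ) : ℤ)) = 2 * k + 2 by push_cast; ring]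
    ring
  have hs : Summable (thetaTerm q) := by
    simp only [funext (thetaTerm_eq q)]
    exact (summable_of_pow_le hq fun k => by nlinarith).add
      (summable_of_pow_le hq fun k => by nlinarith)
  have hlim : Tendsto H atTop (𝓝 0) := by
    obtain ⟨C, hC⟩ := exists_norm_qF_le hq
    refine squeeze_zero_norm (a := fun k => ‖q‖ ^ (3 * k ^ 2) * (‖qPochInf (q ^ 2) (q ^ 2)‖ * C))
      (fun k => ?_) (by simpa using (tendsto_const_mul_pow_sq hq).mul_const _)
    simp only [hH, norm_mul, norm_pow, norm_neg, norm_one, one_pow, one_mul, mul_assoc]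
    gcongr
    exact hC _
  have hsj := (summable_nat_add_iff j).mpr hs
  refine (hsj.hasSum_iff_tendsto_nat).mpr ?_
  have : Tendsto (fun n => H j - H (n + j)) atTop (𝓝 (H j - 0)) :=
    (hlim.comp (tendsto_add_atTop_nat j)).const_sub _
  rw [sub_zero] at this
  refine this.congr fun n => ?_
  rw [Finset.sum_congr rfl fun i _ => htel (i + j)]
  have := Finset.sum_range_sub' (fun i => H (i + j)) n
  simp only [zero_add] at this
  rw [← this]
  exact Finset.sum_congr rfl fun i _ => by rw [show i + j + 1 = i + 1 + j by ring]

/-- Half the sum of the signs of `k + 1/3 - j` and `k + 1/3 + j`, the indicator function of the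
cone of the indefinite theta series, with orientation. -/
def coneSign (k j : ℤ) : ℂ :=
  ((Real.sign ((k : ℝ) + 1 / 3 - j) : ℂ) + (Real.sign ((k : ℝ) + 1 / 3 + j) : ℂ)) / 2

theorem sign_add_third_of_nonneg {m : ℤ} (h : 0 ≤ m) : Real.sign ((m : ℝ) + 1 / 3) = 1 := by
  have : (0 : ℝ) ≤ m := by exact_mod_cast h
  exact Real.sign_of_pos (by linarith)

theorem sign_add_third_of_neg {m : ℤ} (h : m < 0) : Real.sign ((m : ℝ) + 1 / 3) = -1 := by
  have : (m : ℝ) ≤ -1 := by exact_mod_cast (by omega : m ≤ -1)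
  exact Real.sign_of_neg (by linarith)

theorem coneSign_eq (k j : ℤ) : coneSign k j =
    ((Real.sign (((k - j : ℤ) : ℝ) + 1 / 3) : ℂ) + (Real.sign (((k + j : ℤ) : ℝ) + 1 / 3) : ℂ)) / 2 := by
  rw [coneSign]; push_cast; congr 4 <;> ring

theorem coneSign_natCast (n : ℕ) (j : ℤ) : coneSign n j = if j.natAbs ≤ n then 1 else 0 := by
  rw [coneSign_eq]
  split_ifs with h
  · rw [sign_add_third_of_nonneg (by omega), sign_add_third_of_nonneg (by omega)]; norm_num
  · rcases le_total 0 j with hj | hj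
    · rw [sign_add_third_of_neg (by omega), sign_add_third_of_nonneg (by omega)]; norm_num
    · rw [sign_add_third_of_nonneg (by omega), sign_add_third_of_neg (by omega)]; norm_num

theorem coneSign_neg_add_one (n : ℕ) (j : ℤ) :
    coneSign (-(n + 1)) j = if j.natAbs ≤ n then -1 else 0 := by
  rw [coneSign_eq]
  split_ifs with h
  · rw [sign_add_third_of_neg (by omega), sign_add_third_of_neg (by omega)]; norm_num
  · rcases le_total 0 j with hj | hj
    · rw [sign_add_third_of_neg (by omega), sign_add_third_of_nonneg (by omega)]; norm_num
    · rw [sign_add_third_of_nonneg (by omega), sign_add_third_of_neg (by omega)]; norm_num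

theorem hasSum_if_le {f : ℕ → ℂ} {a : ℂ} (N : ℕ) (h : HasSum (fun k => f (k + N)) a) :
    HasSum (fun n => if N ≤ n then f n else 0) a := by
  rw [← (add_left_injective N).hasSum_iff]
  · have e : (fun n => if N ≤ n then f n else 0) ∘ (· + N) = fun k => f (k + N) := by
      funext k; simp
    rwa [e]
  · intro n hn
    rw [if_neg]
    intro h
    exact hn ⟨n - N, Nat.sub_add_cancel h⟩

theorem hasSum_hecke_fiber {q : ℂ} (hq0 : q ≠ 0) (hq : ‖q‖ < 1) (j : ℤ) :
    HasSum (fun k : ℤ => (-1) ^ (k + j) * coneSign k j * q ^ (3 * k ^ 2 + 2 * k - j ^ 2))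
      (qPochInf (q ^ 2) (q ^ 2) * (q ^ (2 * j ^ 2) * qF q (2 * j))) := by
  set N := j.natAbs with hN
  set f1 : ℕ → ℂ := fun k => (-1) ^ k * q ^ (3 * k ^ 2 + 2 * k)
  set f2 : ℕ → ℂ := fun k => (-1) ^ k * q ^ (3 * k ^ 2 + 4 * k + 1)
  have s1 : Summable f1 := summable_of_pow_le hq fun k => by nlinarith
  have s2 : Summable f2 := summable_of_pow_le hq fun k => by nlinarith
  have t1 := ((summable_nat_add_iff N).mpr s1).hasSum
  have t2 := ((summable_nat_add_iff N).mpr s2).hasSum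
  have hsum : ∑' k, f1 (k + N) + ∑' k, f2 (k + N) =
      (-1) ^ N * q ^ (3 * N ^ 2) * qPochInf (q ^ 2) (q ^ 2) * qF q (2 * N) :=
    (t1.add t2).unique (hasSum_of_eq (hasSum_theta_tail hq0 hq N)
      (fun k => (thetaTerm_eq q (k + N)).symm) rfl)
  have hF : qF q (2 * N) = qF q (2 * j) := by
    rcases Int.natAbs_eq j with h | h
    · rw [← h]
    · rw [show 2 * j = -(2 * (N : ℤ)) by omega, qF_neg]
  have hj1 : (-1 : ℂ) ^ j = (-1) ^ N := by
    rcases Int.natAbs_eq j with h | h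
    · rw [h, zpow_natCast]
    · rw [h, zpow_neg, zpow_natCast, ← inv_pow, hN]; norm_num
  have hj2 : (-1 : ℂ) ^ N * (-1) ^ N = 1 := by rw [← mul_pow]; norm_num
  have hjN : j ^ 2 = ((N ^ 2 : ℕ) : ℤ) := by rw [hN]; push_cast; rw [sq_abs]
  set c : ℂ := (-1) ^ N * (q ^ (N ^ 2))⁻¹ with hc
  have hcexp : ∀ m : ℕ, q ^ ((m : ℤ) - j ^ 2) = q ^ m * (q ^ (N ^ 2))⁻¹ := fun m => by
    rw [hjN, zpow_sub₀ hq0, zpow_natCast, zpow_natCast, div_eq_mul_inv]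
  -- The indices $k=n$ and $k=-(n+1)$ supply the two halves of `thetaTerm`: for the latter
  -- $3k^2+2k=3n^2+4n+1$, and the sign $-1$ of the negative cone cancels that of $(-1)^{n+1}$. The
  -- cone condition $|j|\le n$ starts both sums at $N=|j|$.
  refine hasSum_of_eq (HasSum.of_nat_of_neg_add_one
    (f := fun k : ℤ => (-1) ^ (k + j) * coneSign k j * q ^ (3 * k ^ 2 + 2 * k - j ^ 2))
    (hasSum_of_eq ((hasSum_if_le N t1).mul_left c) (fun n => ?_) rfl)
    (hasSum_of_eq ((hasSum_if_le N t2).mul_left c) (fun n => ?_) rfl)) (fun k => rfl) ?_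
  · rw [coneSign_natCast]
    split_ifs
    · rw [show 3 * (n : ℤ) ^ 2 + 2 * n - j ^ 2 = ((3 * n ^ 2 + 2 * n : ℕ) : ℤ) - j ^ 2 by push_cast; ring,
        hcexp, zpow_add₀ (by norm_num), zpow_natCast, hj1]
      simp only [hc, f1]; ring
    · ring
  · rw [coneSign_neg_add_one]
    split_ifs
    · rw [show 3 * (-((n : ℤ) + 1)) ^ 2 + 2 * (-((n : ℤ) + 1)) - j ^ 2 =
          ((3 * n ^ 2 + 4 * n + 1 : ℕ) : ℤ) - j ^ 2 by push_cast; ring,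
        hcexp, zpow_add₀ (by norm_num), zpow_neg, ← inv_zpow, inv_neg, inv_one, ← Nat.cast_add_one,
        zpow_natCast, hj1]
      simp only [hc, f2]; ring
    · ring
  · rw [← mul_add, hsum, hF, hc]
    have h1 : q ^ (3 * N ^ 2) = q ^ (2 * j ^ 2) * q ^ (N ^ 2) := by
      rw [hjN]; norm_cast; ring
    rw [h1]
    have h2 : q ^ (N ^ 2) ≠ 0 := pow_ne_zero _ hq0
    calc _ = ((-1) ^ N * (-1) ^ N) * ((q ^ N ^ 2)⁻¹ * q ^ N ^ 2) *
          (qPochInf (q ^ 2) (q ^ 2) * (q ^ (2 * j ^ 2) * qF q (2 * j))) := by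
          rw [hj2, inv_mul_cancel₀ h2]; ring
      _ = _ := by ring

/-- The even part of `S(q)` as an indefinite theta series. -/
theorem tsum_hecke {w : ℂ} (hw0 : w ≠ 0) (hw : ‖w‖ < 1)
    (hs : Summable fun p : ℤ × ℤ => (-1 : ℂ) ^ (p.1 + p.2) * coneSign p.1 p.2 *
      (w ^ 2) ^ (3 * p.1 ^ 2 + 2 * p.1 - p.2 ^ 2)) :
    ∑' p : ℤ × ℤ, (-1 : ℂ) ^ (p.1 + p.2) * coneSign p.1 p.2 *
      (w ^ 2) ^ (3 * p.1 ^ 2 + 2 * p.1 - p.2 ^ 2) =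
    qPochInf ((w ^ 2) ^ 2) ((w ^ 2) ^ 2) * evalSeries (sieve 2 0 seriesS) w := by
  have hq : ‖w ^ 2‖ < 1 := by rw [norm_pow]; exact pow_lt_one₀ (norm_nonneg _) hw two_ne_zero
  have h := ((Equiv.prodComm ℤ ℤ).hasSum_iff.mpr hs.hasSum).prod_fiberwise fun j =>
    hasSum_hecke_fiber (pow_ne_zero 2 hw0) hq j
  exact h.unique ((hasSum_even_part hw0 hw).mul_left _)

/-! ### Two-dimensional Gaussian sums and Poisson summation -/

theorem summable_exp_neg_sq_add_abs {c : ℝ} (hc : 0 < c) (S : ℝ) :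
    Summable fun n : ℤ => Real.exp (-Real.pi * (c * n ^ 2 - 2 * S * |(n : ℝ)|)) := by
  simpa using summable_pow_mul_jacobiTheta₂_term_bound S hc 0

/-- The constant $c=\det/\operatorname{tr}$ is below the smaller eigenvalue: subtracting $c$ from
the diagonal leaves a matrix of determinant $c^2$, and completing the square finishes. -/
theorem posDef_form_le {α β γ : ℝ} (hα : 0 < α) (h : β ^ 2 < α * γ) (x y : ℝ) :
    (α * γ - β ^ 2) / (α + γ) * (x ^ 2 + y ^ 2) ≤ α * x ^ 2 + 2 * β * x * y + γ * y ^ 2 := by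
  have hγ : 0 < γ := by
    by_contra hγ
    nlinarith [sq_nonneg β, mul_nonneg hα.le (not_lt.mp hγ |> sub_nonneg.mpr)]
  set c := (α * γ - β ^ 2) / (α + γ) with hc
  have hc' : c * (α + γ) = α * γ - β ^ 2 := by rw [hc]; field_simp
  have hpos : 0 < α - c := by
    rw [sub_pos, hc, div_lt_iff₀ (by positivity)]
    nlinarith [sq_nonneg β]
  have key : 0 ≤ (α - c) * (α * x ^ 2 + 2 * β * x * y + γ * y ^ 2 - c * (x ^ 2 + y ^ 2)) := by
    have : (α - c) * (α * x ^ 2 + 2 * β * x * y + γ * y ^ 2 - c * (x ^ 2 + y ^ 2)) =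
        ((α - c) * x + β * y) ^ 2 + c ^ 2 * y ^ 2 := by
      linear_combination (-y ^ 2) * hc'
    rw [this]; positivity
  have := nonneg_of_mul_nonneg_right key hpos
  linarith

theorem summable_exp_neg_posDef {α β γ : ℝ} (hα : 0 < α) (h : β ^ 2 < α * γ) (d₀ d₁ d₂ : ℝ) :
    Summable fun p : ℤ × ℤ => Real.exp (-Real.pi * (α * (p.1 : ℝ) ^ 2 +
      2 * β * p.1 * p.2 + γ * (p.2 : ℝ) ^ 2) + d₁ * p.1 + d₂ * p.2 + d₀) := by
  have hγ : 0 < γ := by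
    by_contra hγ
    nlinarith [sq_nonneg β, mul_nonneg hα.le (not_lt.mp hγ |> sub_nonneg.mpr)]
  set c := (α * γ - β ^ 2) / (α + γ) with hc
  have hc0 : 0 < c := div_pos (by linarith) (by linarith)
  have hs := (summable_exp_neg_sq_add_abs hc0 (|d₁| / (2 * Real.pi))).mul_of_nonneg
    (summable_exp_neg_sq_add_abs hc0 (|d₂| / (2 * Real.pi)))
    (fun _ => (Real.exp_pos _).le) (fun _ => (Real.exp_pos _).le)
  refine (hs.mul_right (Real.exp d₀)).of_nonneg_of_le (fun _ => (Real.exp_pos _).le) fun p => ?_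
  rw [← Real.exp_add, ← Real.exp_add]
  refine Real.exp_le_exp.mpr ?_
  have h1 := mul_le_mul_of_nonneg_left (posDef_form_le hα h (p.1 : ℝ) p.2) Real.pi_pos.le
  have h2 : d₁ * p.1 ≤ |d₁| * |(p.1 : ℝ)| := by rw [← abs_mul]; exact le_abs_self _
  have h3 : d₂ * p.2 ≤ |d₂| * |(p.2 : ℝ)| := by rw [← abs_mul]; exact le_abs_self _
  have e : ∀ d x : ℝ, -Real.pi * (c * x ^ 2 - 2 * (|d| / (2 * Real.pi)) * |x|) =
      -(Real.pi * (c * x ^ 2)) + |d| * |x| := fun d x => by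
    have := Real.pi_ne_zero
    field_simp
    ring
  rw [e, e]
  nlinarith

/-- The summand of a two-dimensional theta series. -/
def gaussTerm (A C : ℂ) (B : ℝ) (b₁ b₂ : ℂ) (p : ℤ × ℤ) : ℂ :=
  Complex.exp (-Real.pi * (A * (p.1 : ℂ) ^ 2 + 2 * B * p.1 * p.2 + C * (p.2 : ℂ) ^ 2) +
    2 * Real.pi * (b₁ * p.1 + b₂ * p.2))

theorem norm_gaussTerm (A C : ℂ) (B : ℝ) (b₁ b₂ : ℂ) (p : ℤ × ℤ) :
    ‖gaussTerm A C B b₁ b₂ p‖ = Real.exp (-Real.pi * (A.re * (p.1 : ℝ) ^ 2 +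
      2 * B * p.1 * p.2 + C.re * (p.2 : ℝ) ^ 2) + 2 * Real.pi * b₁.re * p.1 +
      2 * Real.pi * b₂.re * p.2 + 0) := by
  rw [gaussTerm, Complex.norm_exp]
  congr 1
  simp [pow_two]
  ring

theorem summable_norm_gaussTerm {A C : ℂ} {B : ℝ} (hA : 0 < A.re) (hB : B ^ 2 < A.re * C.re)
    (b₁ b₂ : ℂ) : Summable fun p => ‖gaussTerm A C B b₁ b₂ p‖ := by
  simp only [norm_gaussTerm]
  exact summable_exp_neg_posDef hA hB _ _ _

/-- Completing the square in $K$ shows that the modulus of the partially transformed summand in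
`tsum_gaussTerm` is again a real Gaussian. -/
theorem re_sq_div {A : ℂ} (hA : 0 < A.re) (K y : ℝ) :
    ((K + Complex.I * y) ^ 2 / A).re =
      A.re / Complex.normSq A * (K + A.im * y / A.re) ^ 2 - y ^ 2 / A.re := by
  have h : Complex.normSq A ≠ 0 := by
    rw [Ne, Complex.normSq_eq_zero]; rintro rfl; simp at hA
  rw [Complex.div_re]
  have h' := Complex.normSq_apply A
  have e1 : (((K : ℂ) + Complex.I * y) ^ 2).re = K ^ 2 - y ^ 2 := by simp [pow_two]
  have e2 : (((K : ℂ) + Complex.I * y) ^ 2).im = 2 * K * y := by simp [pow_two]; ring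
  rw [e1, e2]
  field_simp
  rw [h']
  ring

/-- Poisson summation for a two-dimensional Gaussian. -/
theorem tsum_gaussTerm {A C : ℂ} {B : ℝ} (hA : 0 < A.re) (hB : B ^ 2 < A.re * C.re) (b₁ b₂ : ℂ) :
    0 < (C - B ^ 2 / A).re ∧
    ∑' p, gaussTerm A C B b₁ b₂ p =
      1 / A ^ (1 / 2 : ℂ) * (1 / (C - B ^ 2 / A) ^ (1 / 2 : ℂ)) * ∑' (k : ℤ) (l : ℤ),
        Complex.exp (-Real.pi / A * (k + Complex.I * b₁) ^ 2 - Real.pi / (C - B ^ 2 / A) *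
          (l + Complex.I * (b₂ + Complex.I * B * (k + Complex.I * b₁) / A)) ^ 2) := by
  have hA0 : A ≠ 0 := by rintro rfl; simp at hA
  have hN : 0 < Complex.normSq A := Complex.normSq_pos.mpr hA0
  set ρ := A.re / Complex.normSq A with hρ
  have hρ0 : 0 < ρ := div_pos hA hN
  have hδ : 0 < C.re - B ^ 2 / A.re := by
    rw [sub_pos, div_lt_iff₀ hA, mul_comm]; exact hB
  have hD : 0 < (C - B ^ 2 / A).re := by
    have h := re_sq_div hA B 0
    simp only [Complex.ofReal_zero, mul_zero, add_zero, zero_div, ne_eq, OfNat.ofNat_ne_zero,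
      not_false_eq_true, zero_pow, sub_zero] at h
    rw [Complex.sub_re, h]
    have : A.re / Complex.normSq A ≤ 1 / A.re := by
      rw [div_le_div_iff₀ hN hA, Complex.normSq_apply]; nlinarith [sq_nonneg A.im]
    have h2 := mul_le_mul_of_nonneg_right this (sq_nonneg B)
    rw [one_div_mul_eq_div] at h2
    linarith
  refine ⟨hD, ?_⟩
  -- The summand after Poisson summation in the first variable only. Its joint summability, proved
  -- next, justifies exchanging sums before the second variable is transformed.
  set g : ℤ × ℤ → ℂ := fun p => Complex.exp (-Real.pi * C * (p.2 : ℂ) ^ 2 + 2 * Real.pi * b₂ * p.2 +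
    -Real.pi / A * (p.1 + Complex.I * (b₁ - B * p.2)) ^ 2) with hg
  have hgs : Summable g := by
    set r := -(A.im * B / A.re) with hr
    set s := -b₁.im + A.im * b₁.re / A.re with hs
    refine Summable.of_norm ((summable_exp_neg_posDef (α := ρ) (β := ρ * r)
      (γ := ρ * r ^ 2 + (C.re - B ^ 2 / A.re)) hρ0 (by nlinarith)
      (-Real.pi * ρ * s ^ 2 + Real.pi * b₁.re ^ 2 / A.re) (-Real.pi * ρ * 2 * s)
      (2 * Real.pi * b₂.re - Real.pi * ρ * 2 * r * s - Real.pi * 2 * b₁.re * B / A.re)).congr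
      fun p => ?_)
    rw [hg, Complex.norm_exp]
    congr 1
    have e : (-Real.pi / A * (p.1 + Complex.I * (b₁ - B * p.2)) ^ 2 : ℂ) =
        (-Real.pi : ℝ) * ((((p.1 : ℝ) - b₁.im : ℝ) + Complex.I * (b₁.re - B * p.2 : ℝ)) ^ 2 / A) := by
      conv_lhs => rw [← Complex.re_add_im b₁]
      push_cast
      rw [div_mul_eq_mul_div, mul_div_assoc]
      congr 3
      linear_combination (b₁.im : ℂ) * Complex.I_mul_I
    rw [e, Complex.add_re, Complex.re_ofReal_mul, re_sq_div hA]
    have e2 : (-Real.pi * C * (p.2 : ℂ) ^ 2 + 2 * Real.pi * b₂ * p.2 : ℂ).re =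
        -Real.pi * C.re * (p.2 : ℝ) ^ 2 + 2 * Real.pi * b₂.re * p.2 := by
      simp [pow_two]
    rw [e2, ← hρ, hr, hs]
    clear_value ρ
    field_simp
    ring
  have hf := (summable_norm_gaussTerm hA hB b₁ b₂).of_norm
  rw [← (Equiv.prodComm ℤ ℤ).tsum_eq, Summable.tsum_prod
    (f := fun c => gaussTerm A C B b₁ b₂ (Equiv.prodComm ℤ ℤ c))
    ((Equiv.prodComm ℤ ℤ).summable_iff.mpr hf)]
  have h1 : ∀ b : ℤ, ∑' a : ℤ, gaussTerm A C B b₁ b₂ (Equiv.prodComm ℤ ℤ (b, a)) =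
      1 / A ^ (1 / 2 : ℂ) * ∑' k : ℤ, g (k, b) := by
    intro b
    have := Complex.tsum_exp_neg_quadratic hA (b₁ - B * b)
    calc _ = ∑' a : ℤ, Complex.exp (-Real.pi * C * (b : ℂ) ^ 2 + 2 * Real.pi * b₂ * b) *
          Complex.exp (-Real.pi * A * a ^ 2 + 2 * Real.pi * (b₁ - B * b) * a) := by
          refine tsum_congr fun a => ?_
          rw [gaussTerm, ← Complex.exp_add]
          congr 1
          simp only [Equiv.prodComm_apply, Prod.swap]
          ring
      _ = _ := by
          rw [tsum_mul_left, this, mul_left_comm, ← tsum_mul_left]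
          congr 1
          refine tsum_congr fun k => ?_
          rw [hg, ← Complex.exp_add]
  simp only [h1]
  rw [tsum_mul_left, mul_assoc]
  congr 1
  rw [Summable.tsum_comm (f := fun k x => g (k, x)) hgs, ← tsum_mul_left]
  refine tsum_congr fun k => ?_
  have h2 := Complex.tsum_exp_neg_quadratic hD (b₂ + Complex.I * B * (k + Complex.I * b₁) / A)
  calc _ = ∑' b : ℤ, Complex.exp (-Real.pi / A * (k + Complex.I * b₁) ^ 2) *
        Complex.exp (-Real.pi * (C - B ^ 2 / A) * b ^ 2 +
          2 * Real.pi * (b₂ + Complex.I * B * (k + Complex.I * b₁) / A) * b) := by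
        refine tsum_congr fun b => ?_
        simp only [hg]
        rw [← Complex.exp_add]
        congr 1
        field_simp
        ring_nf
        simp only [Complex.I_sq]
        ring
    _ = _ := by
        rw [tsum_mul_left, h2, mul_left_comm, ← tsum_mul_left]
        congr 1
        refine tsum_congr fun l => ?_
        rw [← Complex.exp_add]
        congr 1
        ring

theorem summable_exp_neg_forms {m₁ m₂ l₁ l₂ v : ℝ} (hv : 0 < v) (hδ : m₁ * l₂ - m₂ * l₁ ≠ 0)
    (x₀ y₀ d : ℝ) :
    Summable fun p : ℤ × ℤ => Real.exp (-Real.pi * v *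
      ((m₁ * (p.1 + x₀) + m₂ * (p.2 + y₀)) ^ 2 + (l₁ * (p.1 + x₀) + l₂ * (p.2 + y₀)) ^ 2) +
      d * (m₁ * (p.1 + x₀) + m₂ * (p.2 + y₀))) := by
  have h1 : 0 < m₁ ^ 2 + l₁ ^ 2 := by
    rcases eq_or_ne m₁ 0 with rfl | h
    · have : l₁ ≠ 0 := by rintro rfl; simp at hδ
      positivity
    · positivity
  set M₀ := m₁ * x₀ + m₂ * y₀ with hM
  set L₀ := l₁ * x₀ + l₂ * y₀ with hL
  refine (summable_exp_neg_posDef (α := v * (m₁ ^ 2 + l₁ ^ 2)) (β := v * (m₁ * m₂ + l₁ * l₂))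
    (γ := v * (m₂ ^ 2 + l₂ ^ 2)) (by positivity) ?_
    (-Real.pi * v * (M₀ ^ 2 + L₀ ^ 2) + d * M₀) (-2 * Real.pi * v * (M₀ * m₁ + L₀ * l₁) + d * m₁)
    (-2 * Real.pi * v * (M₀ * m₂ + L₀ * l₂) + d * m₂)).congr fun p => ?_
  · have : 0 < v ^ 2 * (m₁ * l₂ - m₂ * l₁) ^ 2 := by positivity
    nlinarith
  · congr 1
    rw [hM, hL]
    ring

/-- A majorant uniform for $|y|<1$, as needed to differentiate the series termwise at $0$. -/
theorem norm_mul_exp_le (a y : ℂ) (X : ℝ) (hy : ‖y‖ < 1) :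
    ‖a * Complex.exp (2 * Real.pi * y * X)‖ ≤
      ‖a‖ * Real.exp (2 * Real.pi * X) + ‖a‖ * Real.exp (-(2 * Real.pi) * X) := by
  rw [norm_mul, Complex.norm_exp, ← mul_add]
  refine mul_le_mul_of_nonneg_left ?_ (norm_nonneg _)
  have h1 : (2 * Real.pi * y * X : ℂ).re = y.re * (2 * Real.pi * X) := by simp; ring
  have h2 : |y.re| ≤ 1 := (Complex.abs_re_le_norm y).trans hy.le
  have h3 : y.re * (2 * Real.pi * X) ≤ |2 * Real.pi * X| := by
    refine (le_abs_self _).trans ?_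
    rw [abs_mul]
    exact mul_le_of_le_one_left (abs_nonneg _) h2
  rw [h1]
  refine (Real.exp_le_exp.mpr h3).trans ?_
  rcases abs_cases (2 * Real.pi * X) with ⟨h, _⟩ | ⟨h, _⟩ <;> rw [h]
  · linarith [Real.exp_pos (-(2 * Real.pi) * X)]
  · rw [← neg_mul]; linarith [Real.exp_pos (2 * Real.pi * X)]

/-- Termwise differentiation of an exponential series. -/
theorem hasDerivAt_tsum_exp {ι : Type*} {a : ι → ℂ} {X : ι → ℝ}
    (h1 : Summable fun i => ‖a i‖ * Real.exp (2 * Real.pi * X i))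
    (h2 : Summable fun i => ‖a i‖ * Real.exp (-(2 * Real.pi) * X i)) :
    HasDerivAt (fun y : ℂ => ∑' i, a i * Complex.exp (2 * Real.pi * y * X i))
      (2 * Real.pi * ∑' i, a i * X i) 0 := by
  have hd : ∀ i, Differentiable ℂ fun y : ℂ => a i * Complex.exp (2 * Real.pi * y * X i) :=
    fun i => by fun_prop
  have hb : ∀ i, ∀ y ∈ Metric.ball (0 : ℂ) 1, ‖a i * Complex.exp (2 * Real.pi * y * X i)‖ ≤
      ‖a i‖ * Real.exp (2 * Real.pi * X i) + ‖a i‖ * Real.exp (-(2 * Real.pi) * X i) :=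
    fun i y hy => norm_mul_exp_le _ _ _ (by simpa using hy)
  have h0 : (0 : ℂ) ∈ Metric.ball (0 : ℂ) 1 := by simp
  have hs := Complex.hasSum_deriv_of_summable_norm (h1.add h2) (fun i => (hd i).differentiableOn)
    Metric.isOpen_ball hb h0
  have hdiff := Complex.differentiableOn_tsum_of_summable_norm (h1.add h2)
    (fun i => (hd i).differentiableOn) Metric.isOpen_ball hb
  have hderiv : ∀ i, deriv (fun y : ℂ => a i * Complex.exp (2 * Real.pi * y * X i)) 0 =
      2 * Real.pi * (a i * X i) := by
    intro i
    have h : HasDerivAt (fun y : ℂ => 2 * Real.pi * y * X i) (2 * Real.pi * 1 * X i : ℂ) 0 :=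
      ((hasDerivAt_id _).const_mul _).mul_const _
    rw [(h.cexp.const_mul (a i)).deriv]
    simp
    ring
  simp only [hderiv] at hs
  rw [← tsum_mul_left, hs.tsum_eq]
  exact ((hdiff 0 h0).differentiableAt (Metric.isOpen_ball.mem_nhds h0)).hasDerivAt

/-- In the right half-plane $\log(x/A)=\log x-\log A$ for principal branches, so the two square
roots produced by Poisson summation multiply to a positive real number. -/
theorem cpow_half_mul_cpow_half {A : ℂ} (hA : 0 < A.re) {x : ℝ} (hx : 0 < x) :
    A ^ (1 / 2 : ℂ) * (x / A) ^ (1 / 2 : ℂ) = (Real.sqrt x : ℝ) := by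
  have hA0 : A ≠ 0 := by rintro rfl; simp at hA
  have harg : A.arg ≠ Real.pi := fun h => by
    have := (Complex.arg_eq_pi_iff.mp h).1
    linarith
  have hx0 : (x : ℂ) ≠ 0 := by exact_mod_cast hx.ne'
  rw [Complex.cpow_def_of_ne_zero hA0, Complex.cpow_def_of_ne_zero (div_ne_zero hx0 hA0),
    div_eq_mul_inv (x : ℂ), Complex.log_ofReal_mul hx (inv_ne_zero hA0), Complex.log_inv _ harg,
    ← Complex.exp_add, Real.sqrt_eq_rpow, Real.rpow_def_of_pos hx]
  push_cast
  congr 1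
  ring

/-! ### Siegel theta functions and their modular behaviour -/

/-- The coordinates on `ℝ²` diagonalising the form `6 x² - 2 y²`: the pair
`(indefForm c s x y, indefForm s c x y)` with `c² - s² = 1`. -/
def indefForm (c s x y : ℝ) : ℝ :=
  Real.sqrt 6 * c * x + Real.sqrt 2 * s * y

/-- The coordinates dual to `indefForm`. -/
def dualForm (c s x y : ℝ) : ℝ :=
  c * x / Real.sqrt 6 - s * y / Real.sqrt 2

/-- The Gaussian `exp (π i (τ X² - τ̄ Y²))`. -/
def siegelGauss (τ : ℂ) (X Y : ℝ) : ℂ :=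
  Complex.exp (Real.pi * Complex.I * (τ * (X : ℂ) ^ 2 - (starRingEnd ℂ τ) * (Y : ℂ) ^ 2))

theorem norm_siegelGauss (τ : ℂ) (X Y : ℝ) :
    ‖siegelGauss τ X Y‖ = Real.exp (-Real.pi * τ.im * (X ^ 2 + Y ^ 2)) := by
  rw [siegelGauss, Complex.norm_exp]
  congr 1
  simp [pow_two]
  ring

/-- The Siegel theta function attached to the point `(c, s)` of the hyperbola `c² - s² = 1`. -/
def siegelTheta (τ : ℂ) (c s : ℝ) : ℂ :=
  ∑' p : ℤ × ℤ, (-1 : ℂ) ^ (p.1 + p.2) * siegelGauss τ (indefForm c s (p.1 + 1 / 3) p.2)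
    (indefForm s c (p.1 + 1 / 3) p.2) * (indefForm c s (p.1 + 1 / 3) p.2 : ℝ)

/-- The character appearing in the dual theta function. -/
def dualChar (k : ℤ) : ℂ :=
  Complex.exp (2 * Real.pi * Complex.I * (((k : ℂ) - 1 / 2) / 3))

/-- The theta function dual to `siegelTheta`. -/
def dualTheta (τ : ℂ) (c s : ℝ) : ℂ :=
  ∑' p : ℤ × ℤ, dualChar p.1 * siegelGauss τ (dualForm c s (p.1 - 1 / 2) (p.2 - 1 / 2))
    (dualForm (-s) (-c) (p.1 - 1 / 2) (p.2 - 1 / 2)) *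
    (dualForm c s (p.1 - 1 / 2) (p.2 - 1 / 2) : ℝ)

theorem sqrt_six_mul_sqrt_two : Real.sqrt 6 * Real.sqrt 2 = Real.sqrt 12 := by
  rw [← Real.sqrt_mul (by norm_num)]; norm_num

theorem norm_neg_one_zpow (n : ℤ) : ‖(-1 : ℂ) ^ n‖ = 1 := by simp

theorem summable_siegel {τ : ℂ} (hτ : 0 < τ.im) {c s : ℝ} (hcs : c ^ 2 - s ^ 2 = 1) (d : ℝ) :
    Summable fun p : ℤ × ℤ =>
      ‖(-1 : ℂ) ^ (p.1 + p.2) * siegelGauss τ (indefForm c s (p.1 + 1 / 3) p.2)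
        (indefForm s c (p.1 + 1 / 3) p.2)‖ * Real.exp (d * indefForm c s (p.1 + 1 / 3) p.2) := by
  refine (summable_exp_neg_forms (m₁ := Real.sqrt 6 * c) (m₂ := Real.sqrt 2 * s)
    (l₁ := Real.sqrt 6 * s) (l₂ := Real.sqrt 2 * c) hτ ?_ (1 / 3) 0 d).congr fun p => ?_
  · have : Real.sqrt 6 * c * (Real.sqrt 2 * c) - Real.sqrt 2 * s * (Real.sqrt 6 * s) =
      Real.sqrt 12 := by rw [← sqrt_six_mul_sqrt_two]; linear_combination (Real.sqrt 6 * Real.sqrt 2) * hcs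
    rw [this]; positivity
  · rw [norm_mul, norm_neg_one_zpow, one_mul, norm_siegelGauss, ← Real.exp_add]
    simp only [indefForm, add_zero]

theorem summable_dual {τ : ℂ} (hτ : 0 < τ.im) {c s : ℝ} (hcs : c ^ 2 - s ^ 2 = 1) (d : ℝ) :
    Summable fun p : ℤ × ℤ =>
      ‖dualChar p.1 * siegelGauss τ (dualForm c s (p.1 - 1 / 2) (p.2 - 1 / 2))
        (dualForm (-s) (-c) (p.1 - 1 / 2) (p.2 - 1 / 2))‖ *
        Real.exp (d * dualForm c s (p.1 - 1 / 2) (p.2 - 1 / 2)) := by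
  refine (summable_exp_neg_forms (m₁ := c / Real.sqrt 6) (m₂ := -s / Real.sqrt 2)
    (l₁ := -s / Real.sqrt 6) (l₂ := c / Real.sqrt 2) hτ ?_ (-1 / 2) (-1 / 2) d).congr fun p => ?_
  · have : c / Real.sqrt 6 * (c / Real.sqrt 2) - -s / Real.sqrt 2 * (-s / Real.sqrt 6) =
        1 / Real.sqrt 12 := by
      rw [← sqrt_six_mul_sqrt_two, ← hcs]; field_simp
    rw [this]; positivity
  · have h1 : ‖dualChar p.1‖ = 1 := by
      rw [dualChar, show (2 * Real.pi * Complex.I * (((p.1 : ℂ) - 1 / 2) / 3) : ℂ) =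
        ((2 * Real.pi * (((p.1 : ℝ) - 1 / 2) / 3) : ℝ) : ℂ) * Complex.I by push_cast; ring,
        Complex.norm_exp_ofReal_mul_I]
    rw [norm_mul, h1, one_mul, norm_siegelGauss, ← Real.exp_add]
    simp only [dualForm]
    congr 1
    ring

/-- The completed square identity behind the two-dimensional Poisson summation. -/
theorem gauss_exponent_identity {p r m₁ m₂ l₁ l₂ u₁ u₂ δ : ℂ} (hp : p ≠ 0) (hr : r ≠ 0)
    (hδ0 : δ ≠ 0) (hδ : m₁ * l₂ - m₂ * l₁ = δ) (hA : p * m₁ ^ 2 + r * l₁ ^ 2 ≠ 0) :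
    u₁ ^ 2 / (p * m₁ ^ 2 + r * l₁ ^ 2) + (u₂ - (p * m₁ * m₂ + r * l₁ * l₂) * u₁ /
      (p * m₁ ^ 2 + r * l₁ ^ 2)) ^ 2 / (p * r * δ ^ 2 / (p * m₁ ^ 2 + r * l₁ ^ 2)) =
    ((l₂ * u₁ - l₁ * u₂) / δ) ^ 2 / p + ((m₁ * u₂ - m₂ * u₁) / δ) ^ 2 / r := by
  field_simp
  rw [← hδ]
  ring

theorem dualForm_mul_sqrt (c s x y : ℝ) :
    dualForm c s x y * Real.sqrt 12 = Real.sqrt 2 * c * x - Real.sqrt 6 * s * y := by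
  rw [dualForm, ← sqrt_six_mul_sqrt_two]
  field_simp

theorem dualForm_combination {c s : ℝ} (hcs : c ^ 2 - s ^ 2 = 1) (x y : ℝ) :
    Real.sqrt 6 * c * dualForm c s x y + Real.sqrt 6 * s * dualForm (-s) (-c) x y = x := by
  rw [dualForm, dualForm]
  field_simp
  linear_combination (Real.sqrt 2 * x) * hcs

/-- Exponent bookkeeping for $\tau\mapsto-1/\tau$ in diagonal coordinates. The right side separates
into the elliptic factor, the character caused by the shift $\frac13$, the dual Gaussian and the
dual elliptic term. -/
theorem exponent_at_inverse {τ τb M₀ L₀ z ξ η : ℂ} (hτ : τ ≠ 0) (hτb : τb ≠ 0) :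
    -(-Complex.I * τ) * M₀ ^ 2 - Complex.I * τb * L₀ ^ 2 + 2 * z * M₀ -
      ((ξ - Complex.I * (-Complex.I * τ * M₀ - z)) ^ 2 / (-Complex.I * τ) +
        (η - Complex.I * (Complex.I * τb * L₀)) ^ 2 / (Complex.I * τb)) =
    Complex.I * z ^ 2 / τ + 2 * Complex.I * (M₀ * ξ + L₀ * η) +
      Complex.I * (-1 / τ * ξ ^ 2 - -1 / τb * η ^ 2) + 2 * (z / τ) * ξ := by
  have hI := Complex.I_sq
  have e1 : ∀ x : ℂ, x / (-Complex.I * τ) = x * Complex.I / τ := fun x => by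
    rw [div_eq_div_iff (mul_ne_zero (neg_ne_zero.mpr Complex.I_ne_zero) hτ) hτ]
    linear_combination (x * τ) * hI
  have e2 : ∀ x : ℂ, x / (Complex.I * τb) = -x * Complex.I / τb := fun x => by
    rw [div_eq_div_iff (mul_ne_zero Complex.I_ne_zero hτb) hτb]
    linear_combination (x * τb) * hI
  have h3 : ξ - Complex.I * (-Complex.I * τ * M₀ - z) = ξ - τ * M₀ + Complex.I * z := by
    linear_combination (τ * M₀) * hI
  have h4 : η - Complex.I * (Complex.I * τb * L₀) = η + τb * L₀ := by
    linear_combination (-τb * L₀) * hI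
  rw [e1, e2, h3, h4]
  field_simp
  linear_combination (-Complex.I * τb * z ^ 2 - 2 * τb * z * (ξ - τ * M₀)) * hI

/-- Poisson summation for `siegelTheta` with an elliptic variable. -/
theorem tsum_siegel_exp {τ : ℂ} (hτ : 0 < τ.im) {c s : ℝ} (hcs : c ^ 2 - s ^ 2 = 1) (z : ℂ) :
    ∑' p : ℤ × ℤ, (-1 : ℂ) ^ (p.1 + p.2) * siegelGauss τ (indefForm c s (p.1 + 1 / 3) p.2)
      (indefForm s c (p.1 + 1 / 3) p.2) *
      Complex.exp (2 * Real.pi * z * (indefForm c s (p.1 + 1 / 3) p.2 : ℝ)) =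
    1 / (Real.sqrt 12 * ‖τ‖) * Complex.exp (Real.pi * Complex.I * z ^ 2 / τ) *
      ∑' p : ℤ × ℤ, dualChar p.1 * siegelGauss (-1 / τ) (dualForm c s (p.1 - 1 / 2) (p.2 - 1 / 2))
        (dualForm (-s) (-c) (p.1 - 1 / 2) (p.2 - 1 / 2)) *
        Complex.exp (2 * Real.pi * (z / τ) * (dualForm c s (p.1 - 1 / 2) (p.2 - 1 / 2) : ℝ)) := by
  have hτ0 : τ ≠ 0 := by rintro rfl; simp at hτ
  have hτb : (starRingEnd ℂ) τ ≠ 0 := by simpa using hτ0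
  set m₁ : ℝ := Real.sqrt 6 * c with hm1
  set m₂ : ℝ := Real.sqrt 2 * s with hm2
  set l₁ : ℝ := Real.sqrt 6 * s with hl1
  set l₂ : ℝ := Real.sqrt 2 * c with hl2
  set δ : ℝ := Real.sqrt 12 with hδdef
  have hδ : m₁ * l₂ - m₂ * l₁ = δ := by
    rw [hδdef, ← sqrt_six_mul_sqrt_two]; linear_combination (Real.sqrt 6 * Real.sqrt 2) * hcs
  have hδ0 : 0 < δ := by positivity
  set P : ℂ := -Complex.I * τ with hP
  set R : ℂ := Complex.I * (starRingEnd ℂ) τ with hR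
  have hP0 : P ≠ 0 := mul_ne_zero (neg_ne_zero.mpr Complex.I_ne_zero) hτ0
  have hR0 : R ≠ 0 := mul_ne_zero Complex.I_ne_zero hτb
  have hPre : P.re = τ.im := by simp [hP]
  have hRre : R.re = τ.im := by simp [hR]
  have hPR : P + R = (2 * τ.im : ℝ) := by
    apply Complex.ext <;> simp [hP, hR]; ring
  have hPR' : P * R = (‖τ‖ ^ 2 : ℝ) := by
    rw [← Complex.normSq_eq_norm_sq, ← Complex.mul_conj, hP, hR]
    linear_combination (-τ * (starRingEnd ℂ) τ) * Complex.I_sq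
  set A : ℂ := P * (m₁ : ℂ) ^ 2 + R * (l₁ : ℂ) ^ 2 with hA
  set C : ℂ := P * (m₂ : ℂ) ^ 2 + R * (l₂ : ℂ) ^ 2 with hC
  set B : ℝ := 2 * τ.im * (m₁ * m₂) with hB
  -- This equality makes the off-diagonal coefficient $(P+R)m_1m_2$ real, as `gaussTerm` requires.
  have hmm : m₁ * m₂ = l₁ * l₂ := by rw [hm1, hm2, hl1, hl2]; ring
  have hBc : (B : ℂ) = P * m₁ * m₂ + R * l₁ * l₂ := by
    have : (m₁ : ℂ) * m₂ = l₁ * l₂ := by exact_mod_cast hmm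
    rw [hB, Complex.ofReal_mul, ← hPR]
    push_cast
    linear_combination R * this
  have hAre : A.re = τ.im * (m₁ ^ 2 + l₁ ^ 2) := by
    rw [hA, ← Complex.ofReal_pow, ← Complex.ofReal_pow, Complex.add_re, Complex.re_mul_ofReal,
      Complex.re_mul_ofReal, hPre, hRre]; ring
  have hCre : C.re = τ.im * (m₂ ^ 2 + l₂ ^ 2) := by
    rw [hC, ← Complex.ofReal_pow, ← Complex.ofReal_pow, Complex.add_re, Complex.re_mul_ofReal,
      Complex.re_mul_ofReal, hPre, hRre]; ring
  have hA0 : 0 < A.re := by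
    have : m₁ ^ 2 + l₁ ^ 2 = 6 * (c ^ 2 + s ^ 2) := by
      rw [hm1, hl1, mul_pow, mul_pow, Real.sq_sqrt (by norm_num)]; ring
    rw [hAre, this]
    have : 0 < c ^ 2 + s ^ 2 := by nlinarith [sq_nonneg s]
    positivity
  have hBlt : B ^ 2 < A.re * C.re := by
    have : A.re * C.re - B ^ 2 = τ.im ^ 2 * δ ^ 2 := by
      rw [hAre, hCre, hB, ← hδ]
      linear_combination (-3 * τ.im ^ 2 * (m₁ * m₂) - τ.im ^ 2 * (l₁ * l₂)) * hmm
    have : 0 < τ.im ^ 2 * δ ^ 2 := by positivity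
    linarith
  have hAne : A ≠ 0 := by intro h; rw [h] at hA0; simp at hA0
  have hδc : (m₁ : ℂ) * l₂ - m₂ * l₁ = δ := by exact_mod_cast hδ
  have hδc0 : (δ : ℂ) ≠ 0 := by exact_mod_cast hδ0.ne'
  have hD : C - B ^ 2 / A = P * R * (δ : ℂ) ^ 2 / A := by
    rw [eq_div_iff hAne, sub_mul, div_mul_cancel₀ _ hAne, hBc, ← hδc, hA, hC]; ring
  set M₀ : ℂ := m₁ / 3 with hM₀
  set L₀ : ℂ := l₁ / 3 with hL₀
  -- The term $i/2$ encodes the sign $(-1)^{k+j}$ and becomes the shift by $\frac12$ of the dual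
  -- lattice.
  set b₁ : ℂ := Complex.I / 2 - P * M₀ * m₁ - R * L₀ * l₁ + z * m₁ with hb₁
  set b₂ : ℂ := Complex.I / 2 - P * M₀ * m₂ - R * L₀ * l₂ + z * m₂ with hb₂
  set K : ℂ := Complex.exp (Real.pi * (-P * M₀ ^ 2 - R * L₀ ^ 2 + 2 * z * M₀)) with hK
  have hLHS : ∀ p : ℤ × ℤ, (-1 : ℂ) ^ (p.1 + p.2) * siegelGauss τ
      (indefForm c s (p.1 + 1 / 3) p.2) (indefForm s c (p.1 + 1 / 3) p.2) *
      Complex.exp (2 * Real.pi * z * (indefForm c s (p.1 + 1 / 3) p.2 : ℝ)) =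
      K * gaussTerm A C B b₁ b₂ p := by
    intro p
    have h1 : (-1 : ℂ) ^ (p.1 + p.2) = Complex.exp (((p.1 + p.2 : ℤ) : ℂ) * (Real.pi * Complex.I)) := by
      rw [Complex.exp_int_mul, Complex.exp_pi_mul_I]
    have hM : (indefForm c s (p.1 + 1 / 3) p.2 : ℂ) = M₀ + m₁ * p.1 + m₂ * p.2 := by
      rw [indefForm, ← hm1, ← hm2]; push_cast; ring
    have hL : (indefForm s c (p.1 + 1 / 3) p.2 : ℂ) = L₀ + l₁ * p.1 + l₂ * p.2 := by
      rw [indefForm, ← hl1, ← hl2]; push_cast; ring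
    rw [h1, siegelGauss, gaussTerm, hK, hM, hL, ← Complex.exp_add, ← Complex.exp_add,
      ← Complex.exp_add]
    congr 1
    rw [hBc, hA, hC, hb₁, hb₂, hP, hR]
    push_cast
    ring
  obtain ⟨-, hpois⟩ := tsum_gaussTerm hA0 hBlt b₁ b₂
  have hterm : ∀ k l : ℤ, K * Complex.exp (-Real.pi / A * (k + Complex.I * b₁) ^ 2 -
      Real.pi / (C - B ^ 2 / A) * (l + Complex.I * (b₂ + Complex.I * B * (k + Complex.I * b₁) / A)) ^ 2)
      = Complex.exp (Real.pi * Complex.I * z ^ 2 / τ) * (dualChar k *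
        siegelGauss (-1 / τ) (dualForm c s (k - 1 / 2) (l - 1 / 2))
        (dualForm (-s) (-c) (k - 1 / 2) (l - 1 / 2)) *
        Complex.exp (2 * Real.pi * (z / τ) * (dualForm c s (k - 1 / 2) (l - 1 / 2) : ℝ))) := by
    intro k l
    set ξ : ℝ := dualForm c s (k - 1 / 2) (l - 1 / 2) with hξdef
    set η : ℝ := dualForm (-s) (-c) (k - 1 / 2) (l - 1 / 2) with hηdef
    have hξ : (ξ : ℂ) * δ = l₂ * (k - 1 / 2) - l₁ * (l - 1 / 2) := by
      have := dualForm_mul_sqrt c s (k - 1 / 2) (l - 1 / 2)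
      rw [← hξdef, ← hδdef, ← hl2, ← hl1] at this
      simpa using congrArg Complex.ofReal this
    have hη : (η : ℂ) * δ = m₁ * (l - 1 / 2) - m₂ * (k - 1 / 2) := by
      have := dualForm_mul_sqrt (-s) (-c) (k - 1 / 2) (l - 1 / 2)
      rw [← hηdef, ← hδdef] at this
      have h' : η * δ = m₁ * (l - 1 / 2) - m₂ * (k - 1 / 2) := by rw [this, hm1, hm2]; ring
      simpa using congrArg Complex.ofReal h'
    have hcomb : (m₁ : ℂ) * ξ + l₁ * η = k - 1 / 2 := by
      have := dualForm_combination hcs (k - 1 / 2) (l - 1 / 2)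
      rw [← hξdef, ← hηdef, ← hm1, ← hl1] at this
      simpa using congrArg Complex.ofReal this
    have hu1 : (k : ℂ) + Complex.I * b₁ = (k - 1 / 2) - Complex.I *
        ((P * M₀ - z) * m₁ + R * L₀ * l₁) := by
      rw [hb₁]; linear_combination (1 / 2) * Complex.I_sq
    have hu2 : (l : ℂ) + Complex.I * b₂ = (l - 1 / 2) - Complex.I *
        ((P * M₀ - z) * m₂ + R * L₀ * l₂) := by
      rw [hb₂]; linear_combination (1 / 2) * Complex.I_sq
    have hX : (l₂ * (k + Complex.I * b₁) - l₁ * (l + Complex.I * b₂)) / δ =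
        ξ - Complex.I * (P * M₀ - z) := by
      rw [div_eq_iff hδc0, hu1, hu2]
      linear_combination (-1) * hξ - Complex.I * (P * M₀ - z) * hδc
    have hY : (m₁ * (l + Complex.I * b₂) - m₂ * (k + Complex.I * b₁)) / δ =
        η - Complex.I * (R * L₀) := by
      rw [div_eq_iff hδc0, hu1, hu2]
      linear_combination (-1) * hη - Complex.I * (R * L₀) * hδc
    have hinner : (l : ℂ) + Complex.I * (b₂ + Complex.I * B * (k + Complex.I * b₁) / A) =
        (l + Complex.I * b₂) - B * (k + Complex.I * b₁) / A := by
      linear_combination (B * (k + Complex.I * b₁) / A) * Complex.I_sq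
    have hid := gauss_exponent_identity (u₁ := k + Complex.I * b₁) (u₂ := l + Complex.I * b₂)
      hP0 hR0 hδc0 hδc hAne
    rw [← hA, ← hBc, hX, hY] at hid
    have hexp := exponent_at_inverse (M₀ := M₀) (L₀ := L₀) (z := z) (ξ := ξ) (η := η) hτ0 hτb
    rw [← hP, ← hR, ← hid] at hexp
    have hML : M₀ * ξ + L₀ * η = ((k : ℂ) - 1 / 2) / 3 := by
      rw [← hcomb, hM₀, hL₀]; ring
    rw [hML] at hexp
    rw [hinner, hD, hK, dualChar, siegelGauss, ← Complex.exp_add, ← Complex.exp_add,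
      ← Complex.exp_add, ← Complex.exp_add]
    congr 1
    rw [map_div₀, map_neg, map_one]
    linear_combination Real.pi * hexp
  have hsum : Summable fun p : ℤ × ℤ => dualChar p.1 *
      siegelGauss (-1 / τ) (dualForm c s (p.1 - 1 / 2) (p.2 - 1 / 2))
      (dualForm (-s) (-c) (p.1 - 1 / 2) (p.2 - 1 / 2)) *
      Complex.exp (2 * Real.pi * (z / τ) * (dualForm c s (p.1 - 1 / 2) (p.2 - 1 / 2) : ℝ)) := by
    have him : 0 < (-1 / τ).im := by
      rw [neg_div, one_div, Complex.neg_im, Complex.inv_im, neg_div, neg_neg]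
      exact div_pos hτ (Complex.normSq_pos.mpr hτ0)
    refine Summable.of_norm ((summable_dual him hcs (2 * Real.pi * (z / τ).re)).congr fun p => ?_)
    rw [norm_mul _ (Complex.exp _), Complex.norm_exp]
    congr 2
    simp
  -- The determinant is $PR\,\delta^2=12|\tau|^2>0$, so no root of unity arises.
  have hroot : 1 / A ^ (1 / 2 : ℂ) * (1 / (C - B ^ 2 / A) ^ (1 / 2 : ℂ)) =
      1 / (Real.sqrt 12 * ‖τ‖) := by
    have hx : 0 < ‖τ‖ ^ 2 * δ ^ 2 := by positivity
    have h := cpow_half_mul_cpow_half hA0 hx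
    rw [← mul_pow, Real.sqrt_sq (by positivity)] at h
    rw [hD, hPR', one_div_mul_one_div]
    push_cast at h ⊢
    rw [← mul_pow, h, mul_comm]
  rw [tsum_congr hLHS, tsum_mul_left, hpois, hroot, hsum.tsum_prod, mul_left_comm, mul_assoc]
  congr 1
  rw [← tsum_mul_left, ← tsum_mul_left]
  refine tsum_congr fun k => ?_
  rw [← tsum_mul_left, ← tsum_mul_left]
  exact tsum_congr fun l => hterm k l

theorem im_neg_one_div {τ : ℂ} (hτ : 0 < τ.im) : 0 < (-1 / τ).im := by
  have hτ0 : τ ≠ 0 := by rintro rfl; simp at hτ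
  rw [neg_div, one_div, Complex.neg_im, Complex.inv_im, neg_div, neg_neg]
  exact div_pos hτ (Complex.normSq_pos.mpr hτ0)

/-- The modular inversion of `siegelTheta`. -/
theorem siegelTheta_eq_dualTheta {τ : ℂ} (hτ : 0 < τ.im) {c s : ℝ} (hcs : c ^ 2 - s ^ 2 = 1) :
    siegelTheta τ c s = 1 / (Real.sqrt 12 * ‖τ‖ * τ) * dualTheta (-1 / τ) c s := by
  -- The linear factor in the theta functions is $\frac1{2\pi}$ times the derivative at $z=0$ of the
  -- elliptic version. The factor $e^{\pi iz^2/\tau}$ has zero derivative there, and the chain rule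
  -- for $z/\tau$ yields the extra $1/\tau$.
  have h1 := hasDerivAt_tsum_exp (summable_siegel hτ hcs (2 * Real.pi))
    (summable_siegel hτ hcs (-(2 * Real.pi)))
  have h2 := hasDerivAt_tsum_exp (summable_dual (im_neg_one_div hτ) hcs (2 * Real.pi))
    (summable_dual (im_neg_one_div hτ) hcs (-(2 * Real.pi)))
  have hdiv : HasDerivAt (fun z : ℂ => z / τ) (1 / τ) 0 := (hasDerivAt_id _).div_const _
  have h2' := HasDerivAt.comp_of_eq (0 : ℂ) h2 hdiv (by simp)
  have hq : HasDerivAt (fun z : ℂ => Complex.exp (Real.pi * Complex.I * z ^ 2 / τ)) 0 0 := by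
    have h : HasDerivAt (fun z : ℂ => Real.pi * Complex.I * z ^ 2 / τ)
        (Real.pi * Complex.I * ((2 : ℕ) * (0 : ℂ) ^ 1) / τ) 0 :=
      ((hasDerivAt_pow 2 (0 : ℂ)).const_mul _).div_const _
    simpa using h.cexp
  have h3 := (hq.const_mul (1 / (Real.sqrt 12 * ‖τ‖) : ℂ)).mul h2'
  have heq := h1.unique (h3.congr_of_eventuallyEq (Eventually.of_forall fun z =>
    tsum_siegel_exp hτ hcs z))
  have hpi : (2 * Real.pi : ℂ) ≠ 0 := by exact_mod_cast Real.two_pi_pos.ne'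
  refine mul_left_cancel₀ hpi ?_
  rw [siegelTheta, dualTheta, heq]
  simp
  ring

theorem abs_le_exp_add_exp (x : ℝ) : |x| ≤ Real.exp (1 * x) + Real.exp (-1 * x) := by
  rw [one_mul, neg_one_mul]
  have h1 := Real.add_one_le_exp x
  have h2 := Real.add_one_le_exp (-x)
  rw [abs_le]
  constructor <;> linarith [Real.exp_pos x, Real.exp_pos (-x)]

theorem summable_mul_of_exp {ι : Type*} {a : ι → ℂ} {X : ι → ℝ}
    (h1 : Summable fun i => ‖a i‖ * Real.exp (1 * X i))
    (h2 : Summable fun i => ‖a i‖ * Real.exp (-1 * X i)) : Summable fun i => a i * X i := by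
  refine (h1.add h2).of_norm_bounded fun i => ?_
  rw [norm_mul, Complex.norm_real, Real.norm_eq_abs, ← mul_add]
  exact mul_le_mul_of_nonneg_left (abs_le_exp_add_exp _) (norm_nonneg _)

theorem siegelGauss_add_ofReal (τ : ℂ) (a X Y : ℝ) :
    siegelGauss (τ + a) X Y =
      Complex.exp (Real.pi * Complex.I * a * (X ^ 2 - Y ^ 2 : ℝ)) * siegelGauss τ X Y := by
  rw [siegelGauss, siegelGauss, ← Complex.exp_add]
  congr 1
  simp
  ring

theorem indefForm_sq_sub {c s : ℝ} (hcs : c ^ 2 - s ^ 2 = 1) (x y : ℝ) :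
    indefForm c s x y ^ 2 - indefForm s c x y ^ 2 = 6 * x ^ 2 - 2 * y ^ 2 := by
  have h6 : Real.sqrt 6 ^ 2 = 6 := Real.sq_sqrt (by norm_num)
  have h2 : Real.sqrt 2 ^ 2 = 2 := Real.sq_sqrt (by norm_num)
  rw [indefForm, indefForm]
  linear_combination (6 * x ^ 2 - 2 * y ^ 2) * hcs + (c ^ 2 - s ^ 2) * x ^ 2 * h6 -
    (c ^ 2 - s ^ 2) * y ^ 2 * h2

theorem dualForm_sq_sub {c s : ℝ} (hcs : c ^ 2 - s ^ 2 = 1) (x y : ℝ) :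
    dualForm c s x y ^ 2 - dualForm (-s) (-c) x y ^ 2 = x ^ 2 / 6 - y ^ 2 / 2 := by
  have h6 : Real.sqrt 6 ^ 2 = 6 := Real.sq_sqrt (by norm_num)
  have h2 : Real.sqrt 2 ^ 2 = 2 := Real.sq_sqrt (by norm_num)
  have : dualForm c s x y ^ 2 - dualForm (-s) (-c) x y ^ 2 =
      (c ^ 2 - s ^ 2) * (x ^ 2 / Real.sqrt 6 ^ 2 - y ^ 2 / Real.sqrt 2 ^ 2) := by
    rw [dualForm, dualForm]; ring
  rw [this, hcs, h6, h2, one_mul]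

theorem exp_two_pi_I_mul_add_int (x : ℂ) (n : ℤ) :
    Complex.exp (x + n * (2 * Real.pi * Complex.I)) = Complex.exp x := by
  rw [Complex.exp_add, Complex.exp_int_mul_two_pi_mul_I, mul_one]

theorem siegelTheta_add_one (τ : ℂ) {c s : ℝ} (hcs : c ^ 2 - s ^ 2 = 1) :
    siegelTheta (τ + 1) c s = zeta 3 * siegelTheta τ c s := by
  rw [siegelTheta, siegelTheta, ← tsum_mul_left]
  refine tsum_congr fun p => ?_
  have h := siegelGauss_add_ofReal τ 1 (indefForm c s (p.1 + 1 / 3) p.2)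
    (indefForm s c (p.1 + 1 / 3) p.2)
  have he : Complex.exp (Real.pi * Complex.I * (1 : ℝ) *
      (6 * ((p.1 : ℝ) + 1 / 3) ^ 2 - 2 * (p.2 : ℝ) ^ 2 : ℝ)) = zeta 3 := by
    rw [zeta, ← exp_two_pi_I_mul_add_int _ (-(3 * p.1 ^ 2 + 2 * p.1 - p.2 ^ 2))]
    congr 1
    push_cast
    ring
  rw [indefForm_sq_sub hcs, he, Complex.ofReal_one] at h
  rw [h]
  ring

/-- The phase acquired by the terms of `dualTheta` under `τ ↦ τ - 2`. -/
def dualPhase (p : ℤ × ℤ) : ℂ :=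
  Complex.exp (Real.pi * Complex.I * (-2 : ℝ) *
    (((p.1 : ℝ) - 1 / 2) ^ 2 / 6 - ((p.2 : ℝ) - 1 / 2) ^ 2 / 2 : ℝ))

theorem dualPhase_one_sub (p : ℤ × ℤ) : dualPhase (1 - p.1, 1 - p.2) = dualPhase p := by
  rw [dualPhase, dualPhase]
  congr 3
  push_cast
  ring

/-- As $(k-\frac12)^2=k(k-1)+\frac14$, the phase depends on $k(k-1)/6$ modulo $1$, which vanishes
exactly when $k\not\equiv2\pmod 3$; the constants leave $-2(\frac1{24}-\frac18)\pi i=\frac{2\pi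
i}{12}$. -/
theorem dualPhase_eq {p : ℤ × ℤ} (hp : p.1 % 3 ≠ 2) : dualPhase p = zeta 12 := by
  obtain ⟨a, ha⟩ : (6 : ℤ) ∣ p.1 * (p.1 - 1) := by
    have h2 : (2 : ℤ) ∣ p.1 * (p.1 - 1) := (Int.even_mul_pred_self p.1).two_dvd
    have h3 : (3 : ℤ) ∣ p.1 * (p.1 - 1) := by
      rcases (by omega : p.1 % 3 = 0 ∨ p.1 % 3 = 1) with h | h
      · exact Dvd.dvd.mul_right (Int.dvd_of_emod_eq_zero h) _
      · exact Dvd.dvd.mul_left (by omega) _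
    omega
  obtain ⟨b, hb⟩ := (Int.even_mul_pred_self p.2).two_dvd
  have ha' : (p.1 : ℂ) * (p.1 - 1) = 6 * a := by exact_mod_cast ha
  have hb' : (p.2 : ℂ) * (p.2 - 1) = 2 * b := by exact_mod_cast hb
  rw [dualPhase, zeta, ← exp_two_pi_I_mul_add_int _ (a - b)]
  congr 1
  push_cast
  linear_combination (-Real.pi * Complex.I / 3) * ha' + (Real.pi * Complex.I) * hb'

theorem dualChar_eq {k : ℤ} (hk : k % 3 = 2) : dualChar k = -1 := by
  obtain ⟨m, rfl⟩ : ∃ m, k = 3 * m + 2 := ⟨k / 3, by omega⟩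
  rw [dualChar, ← Complex.exp_pi_mul_I, ← exp_two_pi_I_mul_add_int _ (-m)]
  congr 1
  push_cast
  ring

theorem summable_dualTheta {τ : ℂ} (hτ : 0 < τ.im) {c s : ℝ} (hcs : c ^ 2 - s ^ 2 = 1) :
    Summable fun p : ℤ × ℤ => dualChar p.1 * siegelGauss τ
      (dualForm c s (p.1 - 1 / 2) (p.2 - 1 / 2)) (dualForm (-s) (-c) (p.1 - 1 / 2) (p.2 - 1 / 2)) *
      (dualForm c s (p.1 - 1 / 2) (p.2 - 1 / 2) : ℝ) :=
  summable_mul_of_exp (summable_dual hτ hcs 1) (summable_dual hτ hcs (-1))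

theorem dualForm_one_sub (c s : ℝ) (k l : ℤ) :
    dualForm c s ((1 - k : ℤ) - 1 / 2) ((1 - l : ℤ) - 1 / 2) = -dualForm c s (k - 1 / 2) (l - 1 / 2) := by
  rw [dualForm, dualForm]; push_cast; ring

theorem siegelGauss_neg_neg (τ : ℂ) (X Y : ℝ) : siegelGauss τ (-X) (-Y) = siegelGauss τ X Y := by
  simp [siegelGauss]

/-- Terms with $k\not\equiv2\pmod3$ acquire the phase $\zeta_{12}$. Those with $k\equiv2$ cancel in
pairs under $(k,l)\mapsto(1-k,1-l)$, which preserves this class, the character, the Gaussian and the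
phase, but negates the linear form. -/
theorem dualTheta_sub_two {τ : ℂ} (hτ : 0 < τ.im) {c s : ℝ} (hcs : c ^ 2 - s ^ 2 = 1) :
    dualTheta (τ - 2) c s = zeta 12 * dualTheta τ c s := by
  set t : ℤ × ℤ → ℂ := fun p => dualChar p.1 * siegelGauss τ
      (dualForm c s (p.1 - 1 / 2) (p.2 - 1 / 2)) (dualForm (-s) (-c) (p.1 - 1 / 2) (p.2 - 1 / 2)) *
      (dualForm c s (p.1 - 1 / 2) (p.2 - 1 / 2) : ℝ) with ht
  have hs1 : Summable t := summable_dualTheta hτ hcs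
  have hs2 := summable_dualTheta (τ := τ - 2) (by simpa using hτ) hcs
  have hterm : ∀ p : ℤ × ℤ, dualChar p.1 * siegelGauss (τ - 2)
      (dualForm c s (p.1 - 1 / 2) (p.2 - 1 / 2)) (dualForm (-s) (-c) (p.1 - 1 / 2) (p.2 - 1 / 2)) *
      (dualForm c s (p.1 - 1 / 2) (p.2 - 1 / 2) : ℝ) = dualPhase p * t p := by
    intro p
    have h := siegelGauss_add_ofReal τ (-2) (dualForm c s (p.1 - 1 / 2) (p.2 - 1 / 2))
      (dualForm (-s) (-c) (p.1 - 1 / 2) (p.2 - 1 / 2))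
    rw [dualForm_sq_sub hcs, show τ + ((-2 : ℝ) : ℂ) = τ - 2 by push_cast; ring] at h
    rw [h, dualPhase, ht]
    ring
  simp only [hterm] at hs2
  rw [dualTheta, dualTheta, tsum_congr hterm, ← sub_eq_zero, ← tsum_mul_left,
    ← hs2.tsum_sub (hs1.mul_left _)]
  set f : ℤ × ℤ → ℂ := fun p => dualPhase p * t p - zeta 12 * t p with hf
  have hodd : ∀ p : ℤ × ℤ, f (((Equiv.subLeft (1 : ℤ)).prodCongr (Equiv.subLeft (1 : ℤ))) p) = -f p := by
    intro p
    have e : ((Equiv.subLeft (1 : ℤ)).prodCongr (Equiv.subLeft (1 : ℤ))) p = (1 - p.1, 1 - p.2) := rfl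
    rw [e]
    simp only [hf, ← sub_mul, dualPhase_one_sub]
    by_cases hp : p.1 % 3 = 2
    · have hp' : (1 - p.1) % 3 = 2 := by omega
      simp only [ht, dualForm_one_sub, siegelGauss_neg_neg, dualChar_eq hp, dualChar_eq hp']
      push_cast
      ring
    · rw [dualPhase_eq hp, sub_self, zero_mul, zero_mul, neg_zero]
  have h := ((Equiv.subLeft (1 : ℤ)).prodCongr (Equiv.subLeft (1 : ℤ))).tsum_eq f
  rw [tsum_congr hodd, tsum_neg] at h
  exact self_eq_neg.mp h.symm

theorem im_div_two_mul_add_one {τ : ℂ} (hτ : 0 < τ.im) :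
    2 * τ + 1 ≠ 0 ∧ (τ / (2 * τ + 1)).im = τ.im / ‖2 * τ + 1‖ ^ 2 := by
  have h0 : 2 * τ + 1 ≠ 0 := by
    intro h
    have := congrArg Complex.im h
    simp at this
    linarith
  refine ⟨h0, ?_⟩
  rw [Complex.div_im, ← Complex.normSq_eq_norm_sq]
  have : Complex.normSq (2 * τ + 1) ≠ 0 := by simpa using h0
  field_simp
  simp
  ring

theorem siegelTheta_div_two_mul_add_one {τ : ℂ} (hτ : 0 < τ.im) {c s : ℝ}
    (hcs : c ^ 2 - s ^ 2 = 1) :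
    siegelTheta (τ / (2 * τ + 1)) c s =
      zeta 12 * (2 * τ + 1) * ‖2 * τ + 1‖ * siegelTheta τ c s := by
  obtain ⟨h0, him⟩ := im_div_two_mul_add_one hτ
  have hτ0 : τ ≠ 0 := by rintro rfl; simp at hτ
  have hτ' : 0 < (τ / (2 * τ + 1)).im := by rw [him]; positivity
  rw [siegelTheta_eq_dualTheta hτ' hcs, siegelTheta_eq_dualTheta hτ hcs,
    show -1 / (τ / (2 * τ + 1)) = -1 / τ - 2 by field_simp; ring,
    dualTheta_sub_two (im_neg_one_div hτ) hcs, norm_div]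
  push_cast
  field_simp

/-! ### The error function and the incomplete gamma function -/

/-- The error function `2 ∫₀^z exp (-π u²) du`. -/
def erfPi (z : ℝ) : ℝ :=
  ∫ u in (0 : ℝ)..z, 2 * Real.exp (-Real.pi * u ^ 2)

theorem hasDerivAt_erfPi (z : ℝ) : HasDerivAt erfPi (2 * Real.exp (-Real.pi * z ^ 2)) z :=
  (Continuous.integral_hasStrictDerivAt (f := fun u : ℝ => 2 * Real.exp (-Real.pi * u ^ 2))
    (by fun_prop) 0 z).hasDerivAt

theorem erfPi_neg (z : ℝ) : erfPi (-z) = -erfPi z := by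
  have h := intervalIntegral.integral_comp_neg (a := 0) (b := z)
    (fun u : ℝ => 2 * Real.exp (-Real.pi * u ^ 2))
  simp only [neg_sq, neg_zero] at h
  rw [erfPi, erfPi, h, intervalIntegral.integral_symm]

theorem integrableOn_gauss_Ioi (a : ℝ) :
    MeasureTheory.IntegrableOn (fun u : ℝ => 2 * Real.exp (-Real.pi * u ^ 2)) (Set.Ioi a) :=
  ((integrable_exp_neg_mul_sq Real.pi_pos).const_mul 2).integrableOn

theorem integrableOn_incGamma {X : ℝ} (hX : 0 ≤ X) :
    MeasureTheory.IntegrableOn (fun t : ℝ => Real.exp (-t) * t ^ ((1 / 2 : ℝ) - 1)) (Set.Ioi X) :=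
  (Real.GammaIntegral_convergent (by norm_num : (0 : ℝ) < 1 / 2)).mono_set
    (Set.Ioi_subset_Ioi hX)

/-- Substitution $t=\pi u^2$. -/
theorem incGamma_half {z : ℝ} (hz : 0 < z) :
    incGamma (1 / 2) (Real.pi * z ^ 2) =
      Real.sqrt Real.pi * ∫ u in Set.Ioi z, 2 * Real.exp (-Real.pi * u ^ 2) := by
  have hpi := Real.pi_pos
  have himg : (fun u : ℝ => Real.pi * u ^ 2) '' Set.Ici z ⊆ Set.Ioi 0 := by
    rintro _ ⟨u, hu, rfl⟩
    have : 0 < u := lt_of_lt_of_le hz hu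
    simp only [Set.mem_Ioi]; positivity
  have hcomp : ∀ u ∈ Set.Ici z, ((fun t : ℝ => Real.exp (-t) * t ^ ((1 / 2 : ℝ) - 1)) ∘
      fun u : ℝ => Real.pi * u ^ 2) u * (Real.pi * (2 * u)) =
      Real.sqrt Real.pi * (2 * Real.exp (-Real.pi * u ^ 2)) := by
    intro u hu
    have hu0 : 0 < u := lt_of_lt_of_le hz hu
    have h1 : (Real.pi * u ^ 2) ^ ((1 / 2 : ℝ) - 1) = (Real.sqrt Real.pi * u)⁻¹ := by
      rw [show (1 / 2 : ℝ) - 1 = -(1 / 2) by norm_num, Real.rpow_neg (by positivity),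
        ← Real.sqrt_eq_rpow, Real.sqrt_mul hpi.le, Real.sqrt_sq hu0.le]
    simp only [Function.comp]
    rw [h1, ← neg_mul]
    field_simp
    rw [Real.sq_sqrt hpi.le]
  have h := MeasureTheory.integral_comp_mul_deriv_Ioi (f := fun u : ℝ => Real.pi * u ^ 2)
    (f' := fun u => Real.pi * (2 * u)) (g := fun t : ℝ => Real.exp (-t) * t ^ ((1 / 2 : ℝ) - 1))
    (a := z) (by fun_prop)
    ((tendsto_pow_atTop two_ne_zero).const_mul_atTop hpi)
    (fun u _ => by simpa using ((hasDerivAt_pow 2 u).const_mul Real.pi).hasDerivWithinAt)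
    ?_ ?_ ?_
  · rw [incGamma, ← h, ← MeasureTheory.integral_const_mul]
    exact MeasureTheory.setIntegral_congr_fun measurableSet_Ioi fun u hu =>
      hcomp u (Set.Ioi_subset_Ici_self hu)
  · intro t ht
    have ht0 : 0 < t := himg (Set.image_mono Set.Ioi_subset_Ici_self ht)
    exact (by fun_prop : Continuous fun t : ℝ => Real.exp (-t)).continuousWithinAt.mul
      (Real.continuousAt_rpow_const t _ (Or.inl ht0.ne')).continuousWithinAt
  · exact (integrableOn_incGamma le_rfl).mono_set himg
  · exact MeasureTheory.IntegrableOn.congr_fun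
      (((integrable_exp_neg_mul_sq hpi).const_mul 2).const_mul _).integrableOn
      (fun u hu => (hcomp u hu).symm) measurableSet_Ici

theorem erfPi_of_pos {z : ℝ} (hz : 0 < z) :
    erfPi z = 1 - incGamma (1 / 2) (Real.pi * z ^ 2) / Real.sqrt Real.pi := by
  have h := intervalIntegral.integral_interval_add_Ioi (integrableOn_gauss_Ioi 0)
    (integrableOn_gauss_Ioi z)
  have h0 : ∫ u in Set.Ioi (0 : ℝ), 2 * Real.exp (-Real.pi * u ^ 2) = 1 := by
    rw [MeasureTheory.integral_const_mul, integral_gaussian_Ioi, div_self Real.pi_ne_zero]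
    norm_num
  have hp : Real.sqrt Real.pi ≠ 0 := by positivity
  rw [h0] at h
  rw [incGamma_half hz, mul_div_cancel_left₀ _ hp, erfPi]
  linarith

theorem erfPi_eq {z : ℝ} (hz : z ≠ 0) :
    erfPi z = Real.sign z * (1 - incGamma (1 / 2) (Real.pi * z ^ 2) / Real.sqrt Real.pi) := by
  rcases lt_or_gt_of_ne hz with h | h
  · have := erfPi_of_pos (neg_pos.mpr h)
    rw [erfPi_neg, neg_sq] at this
    rw [Real.sign_of_neg h]
    linarith
  · rw [Real.sign_of_pos h, one_mul, erfPi_of_pos h]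

theorem incGamma_half_nonneg {X : ℝ} (hX : 0 ≤ X) : 0 ≤ incGamma (1 / 2) X :=
  MeasureTheory.setIntegral_nonneg measurableSet_Ioi fun t ht => by
    have : 0 < t := lt_of_le_of_lt hX ht
    positivity

theorem incGamma_half_le {X₀ X : ℝ} (h0 : 0 < X₀) (hX : X₀ ≤ X) :
    incGamma (1 / 2) X ≤ X₀ ^ ((1 / 2 : ℝ) - 1) * Real.exp (-X) := by
  rw [← integral_exp_neg_Ioi X, ← MeasureTheory.integral_const_mul]
  refine MeasureTheory.setIntegral_mono_on (integrableOn_incGamma (h0.le.trans hX))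
    ((integrableOn_exp_neg_Ioi X).const_mul _) measurableSet_Ioi fun t ht => ?_
  rw [mul_comm]
  refine mul_le_mul_of_nonneg_right ?_ (Real.exp_pos _).le
  exact Real.rpow_le_rpow_of_nonpos h0 (hX.trans (le_of_lt ht)) (by norm_num)

/-! ### Integration along the geodesic -/

theorem hasDerivAt_indefForm (x y t : ℝ) :
    HasDerivAt (fun t => indefForm (Real.sinh t) (Real.cosh t) x y)
      (indefForm (Real.cosh t) (Real.sinh t) x y) t := by
  have h := (((Real.hasDerivAt_sinh t).const_mul (Real.sqrt 6)).mul_const x).add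
    (((Real.hasDerivAt_cosh t).const_mul (Real.sqrt 2)).mul_const y)
  exact h

theorem continuous_indefForm_cosh (x y : ℝ) :
    Continuous fun t => indefForm (Real.cosh t) (Real.sinh t) x y := by
  simp only [indefForm]
  exact ((continuous_const.mul Real.continuous_cosh).mul continuous_const).add
    ((continuous_const.mul Real.continuous_sinh).mul continuous_const)

theorem continuous_indefForm_sinh (x y : ℝ) :
    Continuous fun t => indefForm (Real.sinh t) (Real.cosh t) x y := by
  simp only [indefForm]
  exact ((continuous_const.mul Real.continuous_sinh).mul continuous_const).add
    ((continuous_const.mul Real.continuous_cosh).mul continuous_const)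

theorem cosh_sq_sub_sinh_sq' (t : ℝ) : Real.cosh t ^ 2 - Real.sinh t ^ 2 = 1 :=
  Real.cosh_sq_sub_sinh_sq t

/-- Splits off the holomorphic factor, which is constant along the hyperbola. What remains depends
on $t$ only through the second coordinate, whose $t$-derivative is the first, so the integrand in
`integral_siegelGauss` is an exact derivative of an error function. -/
theorem siegelGauss_eq {τ : ℂ} {c s : ℝ} (hcs : c ^ 2 - s ^ 2 = 1) (x y : ℝ) :
    siegelGauss τ (indefForm c s x y) (indefForm s c x y) =
      qpow τ (3 * x ^ 2 - y ^ 2) *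
        (Real.exp (-Real.pi * (2 * τ.im) * indefForm s c x y ^ 2) : ℝ) := by
  have h := congrArg Complex.ofReal (indefForm_sq_sub hcs x y)
  have hi : τ - (starRingEnd ℂ) τ = 2 * τ.im * Complex.I := by
    rw [Complex.sub_conj]; push_cast; ring
  rw [siegelGauss, qpow, Complex.ofReal_exp, ← Complex.exp_add]
  congr 1
  push_cast at h ⊢
  linear_combination (Real.pi * Complex.I * τ) * h +
    Real.pi * Complex.I * (indefForm s c x y : ℂ) ^ 2 * hi +
    2 * Real.pi * τ.im * (indefForm s c x y : ℂ) ^ 2 * Complex.I_sq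

/-- The geodesic integral of a single Gaussian. -/
theorem integral_siegelGauss {τ : ℂ} (hτ : 0 < τ.im) (x y a b : ℝ) :
    ∫ t in a..b, siegelGauss τ (indefForm (Real.cosh t) (Real.sinh t) x y)
      (indefForm (Real.sinh t) (Real.cosh t) x y) *
      (indefForm (Real.cosh t) (Real.sinh t) x y : ℝ) =
    qpow τ (3 * x ^ 2 - y ^ 2) *
      (((erfPi (Real.sqrt (2 * τ.im) * indefForm (Real.sinh b) (Real.cosh b) x y) -
        erfPi (Real.sqrt (2 * τ.im) * indefForm (Real.sinh a) (Real.cosh a) x y)) /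
        (2 * Real.sqrt (2 * τ.im)) : ℝ) : ℂ) := by
  set v := Real.sqrt (2 * τ.im) with hv
  have hv0 : 0 < v := by positivity
  have hv2 : v ^ 2 = 2 * τ.im := Real.sq_sqrt (by positivity)
  have hd : ∀ t ∈ Set.uIcc a b, HasDerivAt
      (fun t => erfPi (v * indefForm (Real.sinh t) (Real.cosh t) x y) / (2 * v))
      (Real.exp (-Real.pi * (2 * τ.im) * indefForm (Real.sinh t) (Real.cosh t) x y ^ 2) *
        indefForm (Real.cosh t) (Real.sinh t) x y) t := by
    intro t _
    have h1 := (hasDerivAt_erfPi (v * indefForm (Real.sinh t) (Real.cosh t) x y)).comp t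
      ((hasDerivAt_indefForm x y t).const_mul v)
    refine (h1.div_const (2 * v)).congr_deriv ?_
    rw [mul_pow, hv2, ← mul_assoc (-Real.pi)]
    field_simp
  have hcont : Continuous fun t =>
      Real.exp (-Real.pi * (2 * τ.im) * indefForm (Real.sinh t) (Real.cosh t) x y ^ 2) *
        indefForm (Real.cosh t) (Real.sinh t) x y :=
    (Real.continuous_exp.comp (continuous_const.mul ((continuous_indefForm_sinh x y).pow 2))).mul
      (continuous_indefForm_cosh x y)
  have h := intervalIntegral.integral_eq_sub_of_hasDerivAt hd (hcont.intervalIntegrable a b)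
  rw [sub_div, ← h, ← intervalIntegral.integral_ofReal, ← intervalIntegral.integral_const_mul]
  refine intervalIntegral.integral_congr fun t _ => ?_
  simp only [siegelGauss_eq (cosh_sq_sub_sinh_sq' t)]
  push_cast
  ring

/-- In the null directions $\sqrt6x\pm\sqrt2y$ the hyperbolic rotation acts by $e^{\pm t}$, so it
shrinks the squared norm by at most $e^{-2T}$. -/
theorem indefForm_sq_add_ge (x y : ℝ) {t T : ℝ} (ht : |t| ≤ T) :
    Real.exp (-(2 * T)) * (6 * x ^ 2 + 2 * y ^ 2) ≤
      indefForm (Real.cosh t) (Real.sinh t) x y ^ 2 +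
        indefForm (Real.sinh t) (Real.cosh t) x y ^ 2 := by
  have h6 : Real.sqrt 6 ^ 2 = 6 := Real.sq_sqrt (by norm_num)
  have h2 : Real.sqrt 2 ^ 2 = 2 := Real.sq_sqrt (by norm_num)
  obtain ⟨ht1, ht2⟩ := abs_le.mp ht
  have e1 : Real.exp (-(2 * T)) ≤ Real.exp t ^ 2 := by
    rw [← Real.exp_nat_mul]; exact Real.exp_le_exp.mpr (by push_cast; linarith)
  have e2 : Real.exp (-(2 * T)) ≤ Real.exp (-t) ^ 2 := by
    rw [← Real.exp_nat_mul]; exact Real.exp_le_exp.mpr (by push_cast; linarith)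
  have key : indefForm (Real.cosh t) (Real.sinh t) x y ^ 2 +
      indefForm (Real.sinh t) (Real.cosh t) x y ^ 2 =
      (Real.exp t ^ 2 * (Real.sqrt 6 * x + Real.sqrt 2 * y) ^ 2 +
        Real.exp (-t) ^ 2 * (Real.sqrt 6 * x - Real.sqrt 2 * y) ^ 2) / 2 := by
    rw [indefForm, indefForm, Real.cosh_eq, Real.sinh_eq]; ring
  have h3 : 6 * x ^ 2 + 2 * y ^ 2 = ((Real.sqrt 6 * x + Real.sqrt 2 * y) ^ 2 +
      (Real.sqrt 6 * x - Real.sqrt 2 * y) ^ 2) / 2 := by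
    linear_combination (-x ^ 2) * h6 - y ^ 2 * h2
  rw [key, h3]
  nlinarith [mul_le_mul_of_nonneg_right e1 (sq_nonneg (Real.sqrt 6 * x + Real.sqrt 2 * y)),
    mul_le_mul_of_nonneg_right e2 (sq_nonneg (Real.sqrt 6 * x - Real.sqrt 2 * y))]

/-- Half of the Gaussian decay absorbs the linear factor. -/
theorem abs_mul_exp_neg_le {v : ℝ} (hv : 0 < v) (M L : ℝ) :
    Real.exp (-Real.pi * v * (M ^ 2 + L ^ 2)) * |M| ≤
      (1 + 2 / (Real.pi * v)) * Real.exp (-Real.pi * v / 2 * (M ^ 2 + L ^ 2)) := by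
  have h1 : |M| ≤ 1 + (M ^ 2 + L ^ 2) := by
    rw [← sq_abs M]; nlinarith [sq_nonneg (|M| - 1), sq_nonneg L, abs_nonneg M]
  have h2 := Real.add_one_le_exp (Real.pi * v / 2 * (M ^ 2 + L ^ 2))
  have h3 : 1 + (M ^ 2 + L ^ 2) ≤
      (1 + 2 / (Real.pi * v)) * (Real.pi * v / 2 * (M ^ 2 + L ^ 2) + 1) := by
    have : (1 + 2 / (Real.pi * v)) * (Real.pi * v / 2 * (M ^ 2 + L ^ 2) + 1) =
        1 + (M ^ 2 + L ^ 2) + (2 / (Real.pi * v) + Real.pi * v / 2 * (M ^ 2 + L ^ 2)) := by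
      field_simp; ring
    rw [this]
    exact le_add_of_nonneg_right (by positivity)
  have h4 : |M| ≤ (1 + 2 / (Real.pi * v)) * Real.exp (Real.pi * v / 2 * (M ^ 2 + L ^ 2)) :=
    h1.trans (h3.trans (mul_le_mul_of_nonneg_left h2 (by positivity)))
  calc _ ≤ Real.exp (-Real.pi * v * (M ^ 2 + L ^ 2)) *
        ((1 + 2 / (Real.pi * v)) * Real.exp (Real.pi * v / 2 * (M ^ 2 + L ^ 2))) :=
        mul_le_mul_of_nonneg_left h4 (Real.exp_pos _).le
    _ = _ := by
        rw [mul_left_comm, ← Real.exp_add]; congr 2; ring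

/-- The series `siegelTheta` may be integrated termwise along the hyperbola. -/
theorem hasSum_integral_siegelTheta {τ : ℂ} (hτ : 0 < τ.im) {T : ℝ} (hT : 0 ≤ T) :
    HasSum (fun p : ℤ × ℤ => ∫ t in -T..T, (-1 : ℂ) ^ (p.1 + p.2) *
      siegelGauss τ (indefForm (Real.cosh t) (Real.sinh t) (p.1 + 1 / 3) p.2)
        (indefForm (Real.sinh t) (Real.cosh t) (p.1 + 1 / 3) p.2) *
        (indefForm (Real.cosh t) (Real.sinh t) (p.1 + 1 / 3) p.2 : ℝ))
      (∫ t in -T..T, siegelTheta τ (Real.cosh t) (Real.sinh t)) := by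
  set u : ℤ × ℤ → ℝ := fun p => (1 + 2 / (Real.pi * τ.im)) *
    Real.exp (-Real.pi * (τ.im / 2 * Real.exp (-(2 * T))) *
      (6 * ((p.1 : ℝ) + 1 / 3) ^ 2 + 2 * (p.2 : ℝ) ^ 2)) with hu
  have hus : Summable u := by
    refine Summable.mul_left _ ((summable_exp_neg_forms (m₁ := Real.sqrt 6) (m₂ := 0) (l₁ := 0)
      (l₂ := Real.sqrt 2) (v := τ.im / 2 * Real.exp (-(2 * T))) (by positivity) ?_
      (1 / 3) 0 0).congr fun p => ?_)
    · rw [mul_zero, sub_zero]; positivity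
    · have h6 : Real.sqrt 6 ^ 2 = 6 := Real.sq_sqrt (by norm_num)
      have h2 : Real.sqrt 2 ^ 2 = 2 := Real.sq_sqrt (by norm_num)
      congr 1
      linear_combination (-Real.pi * (τ.im / 2 * Real.exp (-(2 * T))) * ((p.1 : ℝ) + 1 / 3) ^ 2) * h6 -
        (Real.pi * (τ.im / 2 * Real.exp (-(2 * T))) * (p.2 : ℝ) ^ 2) * h2
  refine intervalIntegral.hasSum_integral_of_dominated_convergence (fun p _ => u p)
    (fun p => ?_) (fun p => ?_) (Eventually.of_forall fun t _ => hus) (by simp)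
    (Eventually.of_forall fun t _ => ?_)
  · refine Continuous.aestronglyMeasurable ?_
    have h1 := Complex.continuous_ofReal.comp (continuous_indefForm_cosh ((p.1 : ℝ) + 1 / 3) p.2)
    have h2 := Complex.continuous_ofReal.comp (continuous_indefForm_sinh ((p.1 : ℝ) + 1 / 3) p.2)
    simp only [siegelGauss]
    exact (continuous_const.mul (Complex.continuous_exp.comp (continuous_const.mul
      ((continuous_const.mul (h1.pow 2)).sub (continuous_const.mul (h2.pow 2)))))).mul h1
  · refine Eventually.of_forall fun t ht => ?_
    rw [Set.uIoc_of_le (by linarith)] at ht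
    have ht' : |t| ≤ T := abs_le.mpr ⟨ht.1.le, ht.2⟩
    rw [norm_mul, norm_mul, norm_neg_one_zpow, one_mul, norm_siegelGauss, Complex.norm_real,
      Real.norm_eq_abs]
    refine (abs_mul_exp_neg_le hτ _ _).trans (mul_le_mul_of_nonneg_left ?_ (by positivity))
    refine Real.exp_le_exp.mpr ?_
    have := mul_le_mul_of_nonneg_left (indefForm_sq_add_ge ((p.1 : ℝ) + 1 / 3) p.2 ht')
      (by positivity : 0 ≤ Real.pi * τ.im / 2)
    linarith
  · exact (summable_mul_of_exp (summable_siegel hτ (cosh_sq_sub_sinh_sq' t) 1)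
      (summable_siegel hτ (cosh_sq_sub_sinh_sq' t) (-1))).hasSum

/-- The end point of the geodesic. -/
def geoEnd : ℝ :=
  Real.arsinh (Real.sqrt 2 / 2)

theorem geoEnd_nonneg : 0 ≤ geoEnd :=
  Real.arsinh_nonneg_iff.mpr (by positivity)

theorem sinh_geoEnd : Real.sinh geoEnd = Real.sqrt 2 / 2 := Real.sinh_arsinh _

/-- At $\sinh t=\sqrt2/2$, $\cosh t=\sqrt6/2$ the form is proportional to $x+y$, and at $-t$ to
$x-y$: the arc ends exactly at the walls of the cone. -/
theorem sqrt_mul_indefForm_geoEnd {v : ℝ} (hv : 0 < v) (x y : ℝ) :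
    Real.sqrt (2 * v) * indefForm (Real.sinh geoEnd) (Real.cosh geoEnd) x y =
      Real.sqrt (6 * v) * (x + y) ∧
    Real.sqrt (2 * v) * indefForm (Real.sinh (-geoEnd)) (Real.cosh (-geoEnd)) x y =
      -(Real.sqrt (6 * v) * (x - y)) := by
  have h2 : Real.sqrt 2 ^ 2 = 2 := Real.sq_sqrt (by norm_num)
  have h3 : Real.sqrt 6 = Real.sqrt 2 * Real.sqrt 3 := by
    rw [← Real.sqrt_mul (by norm_num)]; norm_num
  have h6 : Real.sqrt (6 * v) = Real.sqrt (2 * v) * Real.sqrt 3 := by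
    rw [← Real.sqrt_mul (by positivity)]; congr 1; ring
  have hc : Real.cosh geoEnd = Real.sqrt 2 * Real.sqrt 3 / 2 := by
    rw [geoEnd, Real.cosh_arsinh, ← h3, Real.sqrt_eq_iff_mul_self_eq (by positivity) (by positivity),
      div_mul_div_comm, Real.mul_self_sqrt (by norm_num), div_pow, h2]
    norm_num
  rw [Real.sinh_neg, Real.cosh_neg, sinh_geoEnd, hc, indefForm, indefForm, h6, h3]
  constructor
  · linear_combination (Real.sqrt (2 * v) * Real.sqrt 3 * (x + y) / 2) * h2
  · linear_combination (Real.sqrt (2 * v) * Real.sqrt 3 * (y - x) / 2) * h2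

/-- The completed indefinite theta series is a geodesic integral of Siegel theta functions. -/
theorem hasSum_completed {τ : ℂ} (hτ : 0 < τ.im) :
    HasSum (fun p : ℤ × ℤ => (-1 : ℂ) ^ (p.1 + p.2) *
      qpow τ (3 * ((p.1 : ℝ) + 1 / 3) ^ 2 - (p.2 : ℝ) ^ 2) *
      (((erfPi (Real.sqrt (6 * τ.im) * ((p.1 : ℝ) + 1 / 3 + p.2)) +
        erfPi (Real.sqrt (6 * τ.im) * ((p.1 : ℝ) + 1 / 3 - p.2))) / 2 : ℝ) : ℂ))
      (Real.sqrt (2 * τ.im) *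
        ∫ t in -geoEnd..geoEnd, siegelTheta τ (Real.cosh t) (Real.sinh t)) := by
  refine hasSum_of_eq ((hasSum_integral_siegelTheta hτ geoEnd_nonneg).mul_left
    (Real.sqrt (2 * τ.im) : ℂ)) (fun p => ?_) rfl
  simp only [mul_assoc]
  rw [intervalIntegral.integral_const_mul, integral_siegelGauss hτ,
    (sqrt_mul_indefForm_geoEnd hτ _ _).1, (sqrt_mul_indefForm_geoEnd hτ _ _).2, erfPi_neg]
  have h : (Real.sqrt (2 * τ.im) : ℂ) ≠ 0 := by
    exact_mod_cast (by positivity : Real.sqrt (2 * τ.im) ≠ 0)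
  push_cast
  generalize (Real.sqrt (2 * τ.im) : ℂ) = r at *
  field_simp
  ring

/-! ### Splitting the completion into $q^{1/3}A$ and $A^-$ -/

/-- The holomorphic part of the completed indefinite theta series. -/
def holoTerm (τ : ℂ) (p : ℤ × ℤ) : ℂ :=
  (-1 : ℂ) ^ (p.1 + p.2) * qpow τ (3 * ((p.1 : ℝ) + 1 / 3) ^ 2 - (p.2 : ℝ) ^ 2) *
    coneSign p.1 p.2

/-- The contribution of one wall of the cone to the completion. -/
def wallTerm (τ : ℂ) (p : ℤ × ℤ) : ℂ :=
  (-1 : ℂ) ^ (p.1 + p.2) * qpow τ (3 * ((p.1 : ℝ) + 1 / 3) ^ 2 - (p.2 : ℝ) ^ 2) *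
    ((Real.sign ((p.1 : ℝ) + 1 / 3 - p.2) : ℂ) *
      (incGamma (1 / 2) (6 * Real.pi * ((p.1 : ℝ) + 1 / 3 - p.2) ^ 2 * τ.im) : ℂ))

theorem norm_qpow (τ : ℂ) (a : ℝ) : ‖qpow τ a‖ = Real.exp (-(2 * Real.pi * τ.im * a)) := by
  rw [qpow, Complex.norm_exp]
  congr 1
  simp
  ring

theorem one_third_le_abs (m : ℤ) : 1 / 3 ≤ |(m : ℝ) + 1 / 3| := by
  rcases le_or_gt 0 m with h | h
  · have : (0 : ℝ) ≤ m := by exact_mod_cast h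
    rw [abs_of_nonneg (by linarith)]; linarith
  · have : (m : ℝ) ≤ -1 := by exact_mod_cast (by omega : m ≤ -1)
    rw [abs_of_neg (by linarith)]; linarith

theorem one_third_le_abs_sub (k j : ℤ) : 1 / 3 ≤ |(k : ℝ) + 1 / 3 - j| := by
  have := one_third_le_abs (k - j)
  rwa [Int.cast_sub, sub_add_eq_add_sub] at this

theorem norm_sign_le (r : ℝ) : ‖(Real.sign r : ℂ)‖ ≤ 1 := by
  rcases Real.sign_apply_eq r with h | h | h <;> rw [h] <;> simp

/-- With $u=k+\frac13$, the decay $e^{-6\pi v(u-j)^2}$ of the gamma factor makes the indefinite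
exponent definite: $6u^2-2j^2+6(u-j)^2=3(u-j)^2+(3u-j)^2$. The bound needs $|u-j|\ge\frac13$, which
keeps the gamma argument away from $0$. -/
theorem summable_wallTerm {τ : ℂ} (hτ : 0 < τ.im) : Summable (wallTerm τ) := by
  set X₀ := 6 * Real.pi * (1 / 3) ^ 2 * τ.im with hX₀
  have h0 : 0 < X₀ := by positivity
  have hδ : Real.sqrt 3 * 1 - -Real.sqrt 3 * -3 ≠ 0 := by
    have : 0 < Real.sqrt 3 := by positivity
    intro h; linarith
  have hs := (summable_exp_neg_forms (m₁ := Real.sqrt 3) (m₂ := -Real.sqrt 3) (l₁ := -3) (l₂ := 1)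
    hτ hδ (1 / 3) 0 0).mul_left (X₀ ^ ((1 / 2 : ℝ) - 1))
  refine hs.of_norm_bounded fun p => ?_
  have hx := one_third_le_abs_sub p.1 p.2
  have hx2 : (1 / 3) ^ 2 ≤ ((p.1 : ℝ) + 1 / 3 - p.2) ^ 2 := by
    rw [← sq_abs ((p.1 : ℝ) + 1 / 3 - p.2)]; exact pow_le_pow_left₀ (by norm_num) hx 2
  have hX : X₀ ≤ 6 * Real.pi * ((p.1 : ℝ) + 1 / 3 - p.2) ^ 2 * τ.im := by
    rw [hX₀]; gcongr
  have hG : ‖(incGamma (1 / 2) (6 * Real.pi * ((p.1 : ℝ) + 1 / 3 - p.2) ^ 2 * τ.im) : ℂ)‖ =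
      incGamma (1 / 2) (6 * Real.pi * ((p.1 : ℝ) + 1 / 3 - p.2) ^ 2 * τ.im) := by
    rw [Complex.norm_real, Real.norm_of_nonneg (incGamma_half_nonneg (h0.le.trans hX))]
  rw [wallTerm, norm_mul, norm_mul, norm_neg_one_zpow, one_mul, norm_mul, norm_qpow, hG]
  have h1 := mul_le_mul (norm_sign_le ((p.1 : ℝ) + 1 / 3 - p.2)) (incGamma_half_le h0 hX)
    (incGamma_half_nonneg (h0.le.trans hX)) zero_le_one
  refine (mul_le_mul_of_nonneg_left h1 (Real.exp_pos _).le).trans (le_of_eq ?_)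
  rw [one_mul, mul_left_comm, ← Real.exp_add]
  congr 2
  have h3 : Real.sqrt 3 ^ 2 = 3 := Real.sq_sqrt (by norm_num)
  linear_combination (Real.pi * τ.im * ((p.1 : ℝ) + 1 / 3 - p.2) ^ 2) * h3

/-- Reflection in the second coordinate, exchanging the two walls of the cone. -/
def reflectSnd : ℤ × ℤ ≃ ℤ × ℤ :=
  (Equiv.refl ℤ).prodCongr (Equiv.neg ℤ)

theorem neg_one_zpow_add_neg (k j : ℤ) : (-1 : ℂ) ^ (k + -j) = (-1) ^ (k + j) := by
  rw [zpow_add₀ (by norm_num), zpow_add₀ (by norm_num), zpow_neg, ← inv_zpow, inv_neg, inv_one]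

theorem wallTerm_reflectSnd (τ : ℂ) (p : ℤ × ℤ) : wallTerm τ (reflectSnd p) =
    (-1 : ℂ) ^ (p.1 + p.2) * qpow τ (3 * ((p.1 : ℝ) + 1 / 3) ^ 2 - (p.2 : ℝ) ^ 2) *
    ((Real.sign ((p.1 : ℝ) + 1 / 3 + p.2) : ℂ) *
      (incGamma (1 / 2) (6 * Real.pi * ((p.1 : ℝ) + 1 / 3 + p.2) ^ 2 * τ.im) : ℂ)) := by
  have e : reflectSnd p = (p.1, -p.2) := rfl
  rw [e, wallTerm]
  simp only [neg_one_zpow_add_neg, Int.cast_neg, neg_sq, sub_neg_eq_add]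

theorem erfPi_sqrt_mul {v r : ℝ} (hv : 0 < v) (hr : r ≠ 0) :
    erfPi (Real.sqrt (6 * v) * r) =
      Real.sign r - Real.sign r * incGamma (1 / 2) (6 * Real.pi * r ^ 2 * v) / Real.sqrt Real.pi := by
  have h0 : 0 < Real.sqrt (6 * v) := by positivity
  have hs : Real.sign (Real.sqrt (6 * v) * r) = Real.sign r := by
    rcases lt_or_gt_of_ne hr with h | h
    · rw [Real.sign_of_neg h, Real.sign_of_neg (mul_neg_of_pos_of_neg h0 h)]
    · rw [Real.sign_of_pos h, Real.sign_of_pos (mul_pos h0 h)]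
  rw [erfPi_eq (mul_ne_zero h0.ne' hr), hs, mul_pow, Real.sq_sqrt (by positivity),
    show Real.pi * (6 * v * r ^ 2) = 6 * Real.pi * r ^ 2 * v by ring]
  ring

/-- Since $\operatorname{sgn}=\operatorname{erf}+\operatorname{sgn}\cdot\Gamma/\sqrt\pi$ off the
walls, which no lattice point meets, the theta series is the geodesic integral plus half of each
wall sum; by reflection the two halves make one full wall sum. Convergence of the indefinite series
comes out as well. -/
theorem hasSum_holoTerm {τ : ℂ} (hτ : 0 < τ.im) :
    HasSum (holoTerm τ) (Real.sqrt (2 * τ.im) *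
        (∫ t in -geoEnd..geoEnd, siegelTheta τ (Real.cosh t) (Real.sinh t)) +
      1 / (Real.sqrt Real.pi : ℂ) * ∑' p, wallTerm τ p) := by
  have hw := (summable_wallTerm hτ).hasSum
  have hw' := reflectSnd.hasSum_iff.mpr hw
  have h := (hasSum_completed hτ).add (((hw.add hw').div_const 2).mul_left
    (1 / (Real.sqrt Real.pi : ℂ)))
  refine hasSum_of_eq h (fun p => ?_) (by ring)
  have h1 : (p.1 : ℝ) + 1 / 3 - p.2 ≠ 0 := fun h => by
    have := one_third_le_abs_sub p.1 p.2
    rw [h] at this; norm_num at this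
  have h2 : (p.1 : ℝ) + 1 / 3 + p.2 ≠ 0 := fun h => by
    have := one_third_le_abs_sub p.1 (-p.2)
    rw [Int.cast_neg, sub_neg_eq_add, h] at this; norm_num at this
  rw [Function.comp, wallTerm_reflectSnd, erfPi_sqrt_mul hτ h1, erfPi_sqrt_mul hτ h2, holoTerm,
    wallTerm, coneSign]
  push_cast
  ring

/-- The parametrisation of `ℤ²` by the index set of `A⁻`. -/
def wallIndex : Fin 2 × (ℤ × ℤ) ≃ ℤ × ℤ where
  toFun x := (-(x.2.1 + x.2.2 + (x.1 : ℕ) + 1), -(x.2.1 + 3 * x.2.2 + 2 * (x.1 : ℕ) + 1))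
  invFun p := (⟨((p.1 - p.2) % 2).toNat, by omega⟩,
    (-p.1 - (p.1 - p.2) / 2 - (p.1 - p.2) % 2 - 1, (p.1 - p.2) / 2))
  left_inv := by
    rintro ⟨⟨e, he⟩, n, r⟩
    ext <;> simp only <;> omega
  right_inv := by
    rintro ⟨k, j⟩
    ext <;> simp only <;> omega

/-- The exponent is $3u^2-j^2=-\frac32(u-j)^2+\frac12(3u-j)^2$ with $u=k+\frac13$. Here
$u-j=2r+\varepsilon+\frac13$, so $\varepsilon$ is the parity of $k-j$, and
$3u-j=-(2n+\varepsilon+1)$. -/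
theorem wallTerm_wallIndex (τ : ℂ) (x : Fin 2 × (ℤ × ℤ)) : wallTerm τ (wallIndex x) =
    (-1 : ℂ) ^ (x.1 : ℕ) *
      ((Real.sign (2 * (x.2.2 : ℝ) + ((x.1 : ℕ) : ℝ) + 1 / 3) : ℂ) *
      (incGamma (1 / 2) (6 * Real.pi * (2 * (x.2.2 : ℝ) + ((x.1 : ℕ) : ℝ) + 1 / 3) ^ 2 * τ.im) : ℂ) *
      qpow τ (-(3 / 2) * (2 * (x.2.2 : ℝ) + ((x.1 : ℕ) : ℝ) + 1 / 3) ^ 2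
        + 1 / 2 * (2 * (x.2.1 : ℝ) + ((x.1 : ℕ) : ℝ) + 1) ^ 2)) := by
  obtain ⟨e, n, r⟩ := x
  have hs : (-1 : ℂ) ^ ((wallIndex (e, n, r)).1 + (wallIndex (e, n, r)).2) = (-1) ^ (e : ℕ) := by
    have : (wallIndex (e, n, r)).1 + (wallIndex (e, n, r)).2 =
        2 * (-(n + 2 * r + 2 * (e : ℕ) + 1)) + (e : ℕ) := by
      simp only [wallIndex, Equiv.coe_fn_mk]; ring
    rw [this, zpow_add₀ (by norm_num), Even.neg_one_zpow (by simp), one_mul, zpow_natCast]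
  have hx : ((wallIndex (e, n, r)).1 : ℝ) + 1 / 3 - (wallIndex (e, n, r)).2 =
      2 * (r : ℝ) + ((e : ℕ) : ℝ) + 1 / 3 := by
    simp only [wallIndex, Equiv.coe_fn_mk]; push_cast; ring
  have hq : 3 * (((wallIndex (e, n, r)).1 : ℝ) + 1 / 3) ^ 2 - ((wallIndex (e, n, r)).2 : ℝ) ^ 2 =
      -(3 / 2) * (2 * (r : ℝ) + ((e : ℕ) : ℝ) + 1 / 3) ^ 2
        + 1 / 2 * (2 * (n : ℝ) + ((e : ℕ) : ℝ) + 1) ^ 2 := by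
    simp only [wallIndex, Equiv.coe_fn_mk]; push_cast; ring
  rw [wallTerm, hs, hx, hq]
  ring

theorem Aminus_eq {τ : ℂ} (hτ : 0 < τ.im) :
    Aminus τ = -(1 / (Real.sqrt Real.pi : ℂ)) * ∑' p, wallTerm τ p := by
  have hs := wallIndex.summable_iff.mpr (summable_wallTerm hτ)
  rw [Aminus, ← wallIndex.tsum_eq, Summable.tsum_prod (f := fun x => wallTerm τ (wallIndex x)) hs,
    tsum_fintype, ← Fin.sum_univ_eq_sum_range (fun ε => (-1 : ℂ) ^ ε * ∑' p : ℤ × ℤ,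
      (Real.sign (2 * (p.2 : ℝ) + (ε : ℝ) + 1 / 3) : ℂ) *
      (incGamma (1 / 2) (6 * Real.pi * (2 * (p.2 : ℝ) + (ε : ℝ) + 1 / 3) ^ 2 * τ.im) : ℂ) *
      qpow τ (-(3 / 2) * (2 * (p.2 : ℝ) + (ε : ℝ) + 1 / 3) ^ 2
        + 1 / 2 * (2 * (p.1 : ℝ) + (ε : ℝ) + 1) ^ 2)) 2]
  congr 1
  refine Finset.sum_congr rfl fun ε _ => ?_
  rw [← tsum_mul_left]
  exact tsum_congr fun p => (wallTerm_wallIndex τ (ε, p)).symm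

theorem qpow_add (τ : ℂ) (a b : ℝ) : qpow τ (a + b) = qpow τ a * qpow τ b := by
  rw [qpow, qpow, qpow, ← Complex.exp_add]; congr 1; push_cast; ring

theorem qpow_intCast (τ : ℂ) (n : ℤ) : qpow τ n = qpow τ 1 ^ n := by
  rw [qpow, qpow, ← Complex.exp_int_mul]; congr 1; push_cast; ring

theorem qpow_mul_A {τ : ℂ} (hτ : 0 < τ.im) :
    qpow τ (1 / 3) * A τ = ∑' p, holoTerm τ p := by
  set w := qpow τ (1 / 2) with hw
  have hw0 : w ≠ 0 := Complex.exp_ne_zero _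
  have hw1 : ‖w‖ < 1 := by
    rw [hw, norm_qpow, Real.exp_lt_one_iff]
    have := mul_pos Real.pi_pos hτ
    linarith
  have hw2 : w ^ 2 = qpow τ 1 := by
    rw [hw, pow_two, ← qpow_add]; norm_num
  have hterm : ∀ p : ℤ × ℤ, holoTerm τ p = qpow τ (1 / 3) * ((-1 : ℂ) ^ (p.1 + p.2) *
      coneSign p.1 p.2 * (w ^ 2) ^ (3 * p.1 ^ 2 + 2 * p.1 - p.2 ^ 2)) := by
    intro p
    rw [holoTerm, hw2, ← qpow_intCast, show 3 * ((p.1 : ℝ) + 1 / 3) ^ 2 - (p.2 : ℝ) ^ 2 =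
      1 / 3 + ((3 * p.1 ^ 2 + 2 * p.1 - p.2 ^ 2 : ℤ) : ℝ) by push_cast; ring, qpow_add]
    ring
  have hq : qpow τ (1 / 3) ≠ 0 := Complex.exp_ne_zero _
  -- The summability hypothesis of `tsum_hecke` is inherited from the completed series and the wall
  -- terms.
  have hs := (hasSum_holoTerm hτ).summable
  simp only [funext hterm] at hs
  rw [tsum_congr hterm, tsum_mul_left, tsum_hecke hw0 hw1 ((summable_mul_left_iff hq).mp hs), A,
    hw2]

/-- The completed function is a geodesic integral of Siegel theta functions. -/
theorem Ahat_eq_integral {τ : ℂ} (hτ : 0 < τ.im) :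
    Ahat τ = Real.sqrt (2 * τ.im) *
      ∫ t in -geoEnd..geoEnd, siegelTheta τ (Real.cosh t) (Real.sinh t) := by
  rw [Ahat, qpow_mul_A hτ, (hasSum_holoTerm hτ).tsum_eq, Aminus_eq hτ]
  ring

theorem Ahat_add_one {τ : ℂ} (hτ : 0 < τ.im) : Ahat (τ + 1) = zeta 3 * Ahat τ := by
  have him : (τ + 1).im = τ.im := by simp
  rw [Ahat_eq_integral (by rwa [him]), Ahat_eq_integral hτ, him]
  simp only [siegelTheta_add_one τ (cosh_sq_sub_sinh_sq' _)]
  rw [intervalIntegral.integral_const_mul, mul_left_comm]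

/-- The factor $|2\tau+1|$ from the theta function cancels against $\sqrt{\operatorname{Im}}$, which
is divided by $|2\tau+1|$. -/
theorem Ahat_div_two_mul_add_one {τ : ℂ} (hτ : 0 < τ.im) :
    Ahat (τ / (2 * τ + 1)) = zeta 12 * (2 * τ + 1) * Ahat τ := by
  obtain ⟨h0, him⟩ := im_div_two_mul_add_one hτ
  have hn : 0 < ‖2 * τ + 1‖ := norm_pos_iff.mpr h0
  have hτ' : 0 < (τ / (2 * τ + 1)).im := by rw [him]; positivity
  have hr : Real.sqrt (2 * (τ / (2 * τ + 1)).im) = Real.sqrt (2 * τ.im) / ‖2 * τ + 1‖ := by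
    rw [him, ← mul_div_assoc, Real.sqrt_div (by positivity), Real.sqrt_sq hn.le]
  have hn' : (‖2 * τ + 1‖ : ℂ) ≠ 0 := by exact_mod_cast hn.ne'
  rw [Ahat_eq_integral hτ', Ahat_eq_integral hτ, hr]
  simp only [siegelTheta_div_two_mul_add_one hτ (cosh_sq_sub_sinh_sq' _)]
  rw [intervalIntegral.integral_const_mul]
  push_cast
  field_simp

end SievedMock

end

theorem mainTheorem3 (τ : ℂ) (hτ : 0 < τ.im) :
    SievedMock.Ahat (τ + 1) = SievedMock.zeta 3 * SievedMock.Ahat τ ∧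
    SievedMock.Ahat (τ / (2 * τ + 1)) =
      SievedMock.zeta 12 * (2 * τ + 1) * SievedMock.Ahat τ :=
  ⟨SievedMock.Ahat_add_one hτ, SievedMock.Ahat_div_two_mul_add_one hτ⟩
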